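/- Let $k$ be a field and $A$ a commutative $k$-algebra; all (bi)algebras, coalgebras and Hopf algebras are over $k$, unital and counital. A linear map $\psi\colon C\otimes B\to A$, with $C$ a coalgebra and $B$ an algebra, is a \emph{measuring} if $\psi(c,bb')=\sum\psi(c_1,b)\psi(c_2,b')$ and $\psi(c,1)=\varepsilon(c)1_A$. For bialgebras $N,T$, a linear map $\psi\colon N\otimes T\to A$ is a \emph{bimeasuring} if $\psi$ is a measuring and so is $t\otimes n\mapsto\psi(n,t)$; write $\operatorname{Bimeas}(N\otimes T,A)$ for the set of bimeasurings. A bimeasuring $\theta\colon B\otimes T\to A$ is \emph{universal}, and $B=B(T,A)$ is called the universal bimeasuring bialgebra, if for every bialgebra $N$ and every bimeasuring $f\colon N\otimes T\to A$ there is a unique bialgebra map $\overline f\colon N\to B$ with $f=\theta(\overline f\otimes 1)$. \textbf{Theorem.} Every bialgebra $T$ has a universal bimeasuring $\theta_T\colon B(T,A)\otimes T\to A$, and $T\mapsto B(T,A)$ is a contravariant functor from bialgebras to bialgebras, where for a bialgebra map $\alpha\colon S\to T$ the map $B(\alpha,A)\colon B(T,A)\to B(S,A)$ satisfies $\theta_S(B(\alpha,A)\otimes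 1)=\theta_T(1\otimes\alpha)$. This functor is adjoint to itself (on the right): there are bijections, natural in the bialgebras $N$ and $T$, $$\operatorname{Bialg}(T,B(N,A))\;\cong\;\operatorname{Bimeas}(N\otimes T,A)\;\cong\;\operatorname{Bialg}(N,B(T,A)),$$ sending $f\colon T\to B(N,A)$ to $n\otimes t\mapsto\theta_N(f(t),n)$ and $g\colon N\to B(T,A)$ to $\theta_T(g\otimes 1)$, respectively, and the self-adjunction is the composite bijection. Finally, the functor, together with its self-adjunction, restricts to Hopf algebras: there is a contravariant functor $B_H$ from Hopf algebras to Hopf algebras, adjoint to itself on the right, whose underlying bialgebra functor is naturally isomorphic to the restriction of $B(\_,A)$ to Hopf algebras, compatibly with the two adjunctions. -/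

import Mathlib

open CategoryTheory Opposite
open scoped TensorProduct

universe u v w

/-- A linear map `ψ : C ⊗ B → A`, with `C` a coalgebra and `A`, `B` algebras, is a *measuring* if
`ψ(c, b b') = ∑ ψ(c₁, b) ψ(c₂, b')` and `ψ(c, 1) = ε(c) 1`. -/
structure IsMeasuring {k C B A : Type*} [Field k] [AddCommGroup C] [Module k C] [Coalgebra k C]
    [Ring B] [Algebra k B] [Ring A] [Algebra k A] (ψ : C ⊗[k] B →ₗ[k] A) : Prop where
  map_mul : ∀ (c : C) (b b' : B), ψ (c ⊗ₜ[k] (b * b')) =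
    LinearMap.mul' k A
      (TensorProduct.map ((TensorProduct.curry ψ).flip b) ((TensorProduct.curry ψ).flip b')
        (Coalgebra.comul (R := k) c))
  map_one : ∀ c : C, ψ (c ⊗ₜ[k] (1 : B)) = algebraMap k A (Coalgebra.counit (R := k) c)

/-- A linear map `ψ : N ⊗ T → A`, with `N`, `T` bialgebras and `A` an algebra, is a *bimeasuring*
if `N` measures `T` to `A` and `T` measures `N` to `A`. -/
structure IsBimeasuring {k N T A : Type*} [Field k] [Ring N] [Bialgebra k N]
    [Ring T] [Bialgebra k T] [Ring A] [Algebra k A] (ψ : N ⊗[k] T →ₗ[k] A) : Prop where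
  left : IsMeasuring ψ
  right : IsMeasuring (ψ ∘ₗ (TensorProduct.comm k T N).toLinearMap)

/-- The set `Bimeas(N ⊗ T, A)` of bimeasurings. -/
def Bimeas (k N T A : Type*) [Field k] [Ring N] [Bialgebra k N]
    [Ring T] [Bialgebra k T] [Ring A] [Algebra k A] : Type _ :=
  {ψ : N ⊗[k] T →ₗ[k] A // IsBimeasuring ψ}

/-- `θ : B ⊗ T → A` is a (left) *universal bimeasuring*, i.e. `B` is a universal bimeasuring
bialgebra `B(T, A)`: every bimeasuring `f : N ⊗ T → A` is `θ (g ⊗ 1)` for a unique bialgebra map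
`g : N → B`. -/
structure IsUniversalBimeasuring {k : Type u} {B : Type w} {T A : Type*} [Field k]
    [Ring B] [Bialgebra k B] [Ring T] [Bialgebra k T] [Ring A] [Algebra k A]
    (θ : B ⊗[k] T →ₗ[k] A) : Prop where
  isBimeasuring : IsBimeasuring θ
  existsUnique_lift : ∀ (N : Type w) [Ring N] [Bialgebra k N] (f : N ⊗[k] T →ₗ[k] A),
    IsBimeasuring f → ∃! g : N →ₐc[k] B, f = θ ∘ₗ LinearMap.rTensor T (g : N →ₗ[k] B)

/-- The linear map underlying a morphism of bialgebras. -/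
abbrev BialgCat.Hom.toLin {k : Type u} [CommRing k] {X Y : BialgCat.{w} k} (f : X ⟶ Y) :
    X →ₗ[k] Y :=
  (f.toBialgHom : X →ₗ[k] Y)

/-!
The universal bimeasuring bialgebra of a bialgebra `T` is Sweedler's universal measuring coalgebra
`M(T, A)`, with extra structure forced by its universal property.

*Construction.* Every coalgebra is the union of subcoalgebras of countable dimension: in a basis,
close up a basis vector under the finitely many basis vectors occurring in its comultiplication. So
the measurings `V ⊗ T → A` by coalgebras `V` on subspaces of the finitely supported sequences, which
form a small type, see all measurings. Let `M(T, A)` be the direct sum of these `V` modulo the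
largest coideal on which the measuring vanishes. By construction no nonzero coideal of `M(T, A)` is
killed by the induced measuring `θ` (`MeasCoalg.eq_bot_of_isCoideal`). The image of the difference
of two coalgebra maps is a coideal, so coalgebra maps into `M(T, A)` are determined by the measurings
they induce (`MeasCoalg.hom_ext`). This uniqueness also glues the lifts that exist on subcoalgebras
of countable dimension to a lift on any coalgebra (`MeasCoalg.exists_lift`).

*Bialgebra structure.* Since `A` is commutative, `(m ⊗ m', t) ↦ ∑ θ(m, t₁) θ(m', t₂)` is a measuring
by `M(T, A) ⊗ M(T, A)` (`IsMeasuring.convProd`). The coalgebra map it induces is the multiplication;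
the ring axioms follow by uniqueness from those of the convolution algebra of linear maps `T → A`.
Again by uniqueness, the coalgebra map `N → M(T, A)` induced by a bimeasuring is multiplicative, so
`θ` is a universal bimeasuring. As bimeasurings are symmetric in their two arguments, the
self-adjunction and its naturality follow formally.

*Antipode.* If `T` is a Hopf algebra, `(m, t) ↦ θ(m, S t)` is a measuring by the co-opposite of
`M(T, A)` and induces `S : M(T, A) → M(T, A)`. The map `m ↦ ∑ S(m₁) m₂` is not a coalgebra map, but
the image of its difference with `m ↦ ε(m) 1` is still a coideal killed by `θ`, hence zero
(`MeasCoalg.comp_comul_eq_counit`). So the functor preserves Hopf algebras, and as the morphisms of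
Hopf algebras are all bialgebra maps, so does the adjunction.
-/

/-! ### Measurings and coalgebra maps -/

section Measuring

open Coalgebra

variable {k C D B A : Type*} [Field k] [AddCommGroup C] [Module k C] [Coalgebra k C]
  [AddCommGroup D] [Module k D] [Coalgebra k D] [Ring B] [Algebra k B] [Ring A] [Algebra k A]

theorem IsMeasuring.map_mul_repr {ψ : C ⊗[k] B →ₗ[k] A} (h : IsMeasuring ψ) {ι : Type*} {c : C}
    (r : Coalgebra.Repr k c ι) (b b' : B) :
    ψ (c ⊗ₜ[k] (b * b')) =
      ∑ i ∈ r.index, ψ (r.left i ⊗ₜ[k] b) * ψ (r.right i ⊗ₜ[k] b') := by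
  rw [h.map_mul, ← r.eq]
  simp

/-- Pulling a linear map back along a coalgebra map does not change its slice-wise products. -/
theorem mul'_map_comul_comp_coalgHom (ψ : C ⊗[k] B →ₗ[k] A) (f : D →ₗc[k] C) (d : D) (b b' : B) :
    LinearMap.mul' k A (TensorProduct.map
        ((TensorProduct.curry (ψ ∘ₗ LinearMap.rTensor B (f : D →ₗ[k] C))).flip b)
        ((TensorProduct.curry (ψ ∘ₗ LinearMap.rTensor B (f : D →ₗ[k] C))).flip b')
        (comul (R := k) d)) =
      LinearMap.mul' k A (TensorProduct.map ((TensorProduct.curry ψ).flip b)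
        ((TensorProduct.curry ψ).flip b') (comul (R := k) (f d))) := by
  rw [← CoalgHomClass.map_comp_comul_apply f d, ← (ℛ k d).eq]
  simp

theorem IsMeasuring.comp_coalgHom {ψ : C ⊗[k] B →ₗ[k] A} (h : IsMeasuring ψ) (f : D →ₗc[k] C) :
    IsMeasuring (ψ ∘ₗ LinearMap.rTensor B (f : D →ₗ[k] C)) where
  map_mul d b b' := by
    rw [mul'_map_comul_comp_coalgHom, ← h.map_mul]
    simp
  map_one d := by
    simpa using h.map_one (f d)

theorem IsMeasuring.of_surjective {ψ : C ⊗[k] B →ₗ[k] A} (f : D →ₗc[k] C)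
    (hf : Function.Surjective f) (h : IsMeasuring (ψ ∘ₗ LinearMap.rTensor B (f : D →ₗ[k] C))) :
    IsMeasuring ψ where
  map_mul c b b' := by
    obtain ⟨d, rfl⟩ := hf c
    rw [← mul'_map_comul_comp_coalgHom, ← h.map_mul]
    simp
  map_one c := by
    obtain ⟨d, rfl⟩ := hf c
    simpa using h.map_one d

/-- A linear map on a direct sum of coalgebras is a measuring if it is one on each summand. -/
theorem IsMeasuring.of_lsingle {I : Type*} [DecidableEq I] {V : I → Type*}
    [∀ i, AddCommGroup (V i)] [∀ i, Module k (V i)] [∀ i, Coalgebra k (V i)]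
    {ψ : (Π₀ i, V i) ⊗[k] B →ₗ[k] A}
    (h : ∀ i, IsMeasuring (ψ ∘ₗ LinearMap.rTensor B (DFinsupp.lsingle i : V i →ₗ[k] Π₀ i, V i))) :
    IsMeasuring ψ where
  map_mul c b b' := by
    suffices H : (TensorProduct.curry ψ).flip (b * b') = LinearMap.mul' k A ∘ₗ
        TensorProduct.map ((TensorProduct.curry ψ).flip b) ((TensorProduct.curry ψ).flip b') ∘ₗ
          comul from LinearMap.congr_fun H c
    refine DFinsupp.lhom_ext fun i x ↦ ?_
    have := (h i).map_mul x b b'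
    simp only [LinearMap.comp_apply, LinearMap.rTensor_tmul, DFinsupp.lsingle_apply] at this
    simp only [LinearMap.flip_apply, TensorProduct.curry_apply, LinearMap.comp_apply, this,
      DFinsupp.comul_single]
    rw [← (ℛ k x).eq]
    simp
  map_one c := by
    suffices H : (TensorProduct.curry ψ).flip 1 = Algebra.linearMap k A ∘ₗ counit from
      LinearMap.congr_fun H c
    refine DFinsupp.lhom_ext fun i x ↦ ?_
    simpa using (h i).map_one x

end Measuring

/-! ### Subcoalgebras -/

section Subcoalgebra

open Coalgebra

variable {k C E : Type*} [Field k] [AddCommGroup C] [Module k C] [Coalgebra k C]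
  [AddCommGroup E] [Module k E]

/-- A linear left inverse of an injective map of vector spaces. -/
noncomputable def leftInverseOfInjective (ι : E →ₗ[k] C) (hι : Function.Injective ι) : C →ₗ[k] E :=
  (ι.exists_leftInverse_of_injective (LinearMap.ker_eq_bot.2 hι)).choose

omit [Coalgebra k C] in
theorem leftInverseOfInjective_apply (ι : E →ₗ[k] C) (hι : Function.Injective ι) (x : E) :
    leftInverseOfInjective ι hι (ι x) = x :=
  LinearMap.congr_fun
    (ι.exists_leftInverse_of_injective (LinearMap.ker_eq_bot.2 hι)).choose_spec x

/-- The comultiplication induced on a subspace, given as an injective linear map. -/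
noncomputable abbrev coalgebraStructOfInjective (ι : E →ₗ[k] C) (hι : Function.Injective ι) :
    CoalgebraStruct k E where
  comul := TensorProduct.map (leftInverseOfInjective ι hι) (leftInverseOfInjective ι hι) ∘ₗ comul ∘ₗ ι
  counit := counit ∘ₗ ι

theorem map_comp_comul_ofInjective (ι : E →ₗ[k] C) (hι : Function.Injective ι)
    (h : ∀ x, comul (R := k) (ι x) ∈ LinearMap.range (TensorProduct.map ι ι)) :
    letI := coalgebraStructOfInjective ι hι
    TensorProduct.map ι ι ∘ₗ (comul : E →ₗ[k] E ⊗[k] E) = comul ∘ₗ ι := by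
  ext x
  obtain ⟨y, hy⟩ := h x
  have hid : leftInverseOfInjective ι hι ∘ₗ ι = LinearMap.id := LinearMap.ext (leftInverseOfInjective_apply ι hι)
  have : TensorProduct.map (leftInverseOfInjective ι hι) (leftInverseOfInjective ι hι) (TensorProduct.map ι ι y) = y := by
    rw [TensorProduct.map_map, hid, TensorProduct.map_id, LinearMap.id_apply]
  change TensorProduct.map ι ι (TensorProduct.map _ _ (comul (R := k) (ι x))) = comul (ι x)
  rw [← hy, this]

/-- A subspace `E` of a coalgebra `C` with `Δ(E) ⊆ E ⊗ E` is a coalgebra. -/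
noncomputable abbrev coalgebraOfInjective (ι : E →ₗ[k] C) (hι : Function.Injective ι)
    (h : ∀ x, comul (R := k) (ι x) ∈ LinearMap.range (TensorProduct.map ι ι)) :
    Coalgebra k E :=
  letI := coalgebraStructOfInjective ι hι
  have key := map_comp_comul_ofInjective ι hι h
  have key' : ∀ x : E, TensorProduct.map ι ι (comul (R := k) x) = comul (R := k) (ι x) :=
    LinearMap.congr_fun key
  have hcl : (counit : E →ₗ[k] k) = counit ∘ₗ ι := rfl
  { coassoc := by
      have inj : Function.Injective (TensorProduct.map ι (TensorProduct.map ι ι)) :=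
        TensorProduct.map_injective_of_flat_flat _ _ hι
          (TensorProduct.map_injective_of_flat_flat _ _ hι hι)
      ext x
      apply inj
      have h1 : TensorProduct.map ι (TensorProduct.map ι ι)
          ((comul : E →ₗ[k] _).lTensor E (comul (R := k) x)) =
          (comul : C →ₗ[k] _).lTensor C (comul (R := k) (ι x)) := by
        rw [← key', LinearMap.lTensor, LinearMap.lTensor, TensorProduct.map_map,
          TensorProduct.map_map, key]
        rfl
      have h2 : TensorProduct.map (TensorProduct.map ι ι) ι
          ((comul : E →ₗ[k] _).rTensor E (comul (R := k) x)) =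
          (comul : C →ₗ[k] _).rTensor C (comul (R := k) (ι x)) := by
        rw [← key', LinearMap.rTensor, LinearMap.rTensor, TensorProduct.map_map,
          TensorProduct.map_map, key]
        rfl
      simp only [LinearMap.comp_apply, LinearEquiv.coe_coe]
      rw [h1, TensorProduct.map_map_assoc, h2, coassoc_apply]
    rTensor_counit_comp_comul := by
      have inj : Function.Injective (TensorProduct.map (LinearMap.id : k →ₗ[k] k) ι) :=
        TensorProduct.map_injective_of_flat_flat _ _ Function.injective_id hι
      ext x
      apply inj
      rw [LinearMap.comp_apply, hcl, LinearMap.rTensor, TensorProduct.map_map]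
      have := rTensor_counit_comul (R := k) (ι x)
      rw [← key', LinearMap.rTensor, TensorProduct.map_map] at this
      simpa using this
    lTensor_counit_comp_comul := by
      have inj : Function.Injective (TensorProduct.map ι (LinearMap.id : k →ₗ[k] k)) :=
        TensorProduct.map_injective_of_flat_flat _ _ hι Function.injective_id
      ext x
      apply inj
      rw [LinearMap.comp_apply, hcl, LinearMap.lTensor, TensorProduct.map_map]
      have := lTensor_counit_comul (R := k) (ι x)
      rw [← key', LinearMap.lTensor, TensorProduct.map_map] at this
      simpa using this }

/-- The inclusion of a subcoalgebra, as a coalgebra map. -/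
noncomputable def coalgHomOfInjective (ι : E →ₗ[k] C) (hι : Function.Injective ι)
    (h : ∀ x, comul (R := k) (ι x) ∈ LinearMap.range (TensorProduct.map ι ι)) :
    letI := coalgebraOfInjective ι hι h
    E →ₗc[k] C :=
  letI := coalgebraOfInjective ι hι h
  { ι with
    counit_comp := rfl
    map_comp_comul := map_comp_comul_ofInjective ι hι h }

end Subcoalgebra

/-! ### The universal measuring coalgebra -/

section Construction

open Coalgebra

/-- The type of elements of a subspace. It is a type synonym of the subspace
whose additive structure is derived from its additive group. -/
def SubspaceCarrier {k C : Type*} [Field k] [AddCommGroup C] [Module k C] (V : Submodule k C) :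
    Type _ := V

section SubspaceCarrier

variable {k C : Type*} [Field k] [AddCommGroup C] [Module k C] (V : Submodule k C)

noncomputable instance : AddCommGroup (SubspaceCarrier V) := inferInstanceAs (AddCommGroup V)

noncomputable instance : Module k (SubspaceCarrier V) := inferInstanceAs (Module k V)

/-- The inclusion of a subspace. -/
noncomputable def SubspaceCarrier.incl : SubspaceCarrier V →ₗ[k] C := V.subtype

theorem SubspaceCarrier.incl_injective : Function.Injective (SubspaceCarrier.incl V) :=
  Subtype.val_injective

end SubspaceCarrier

/-- A space of countable dimension, realized as a subspace of the space of finitely supported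
sequences. -/
def CountableSpace {k : Type u} [Field k] (V : Submodule k (ℕ →₀ k)) : Type u := SubspaceCarrier V

noncomputable instance {k : Type u} [Field k] (V : Submodule k (ℕ →₀ k)) :
    AddCommGroup (CountableSpace V) := inferInstanceAs (AddCommGroup V)

noncomputable instance {k : Type u} [Field k] (V : Submodule k (ℕ →₀ k)) :
    Module k (CountableSpace V) := inferInstanceAs (Module k V)

/-- The inclusion of a space of countable dimension into the finitely supported sequences. -/
noncomputable def CountableSpace.incl {k : Type u} [Field k] (V : Submodule k (ℕ →₀ k)) :
    CountableSpace V →ₗ[k] (ℕ →₀ k) := V.subtype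

/-- A measuring `V ⊗ T → A` whose coalgebra `V` lives on a subspace of the space of finitely
supported sequences, so that up to isomorphism every measuring by a coalgebra of countable dimension
occurs. These form a small type. -/
structure CountableMeasuring (k : Type u) (T : Type w) (A : Type v) [Field k] [Ring T]
    [Algebra k T] [Ring A] [Algebra k A] where
  /-- The underlying space of the coalgebra. -/
  subspace : Submodule k (ℕ →₀ k)
  [coalgebra : Coalgebra k (CountableSpace subspace)]
  /-- The measuring. -/
  eval : CountableSpace subspace ⊗[k] T →ₗ[k] A
  isMeasuring : IsMeasuring eval

attribute [instance] CountableMeasuring.coalgebra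

variable (k : Type u) (T : Type w) (A : Type v) [Field k] [Ring T] [Algebra k T] [Ring A]
  [Algebra k A]

noncomputable instance : DecidableEq (CountableMeasuring k T A) := Classical.decEq _

/-- The direct sum of the coalgebras of all countable measurings. -/
abbrev CountableMeasuring.Sum : Type _ := Π₀ i : CountableMeasuring k T A, CountableSpace i.subspace

/-- The measuring on the direct sum that restricts to the given one on each summand. -/
noncomputable def CountableMeasuring.sumEval : CountableMeasuring.Sum k T A ⊗[k] T →ₗ[k] A :=
  TensorProduct.lift (DFinsupp.lsum k fun i ↦ TensorProduct.curry i.eval)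

theorem CountableMeasuring.sumEval_comp_lsingle (i : CountableMeasuring k T A) :
    CountableMeasuring.sumEval k T A ∘ₗ
      LinearMap.rTensor T (DFinsupp.lsingle (M := fun i : CountableMeasuring k T A ↦ CountableSpace i.subspace) i) =
        i.eval := by
  ext x t
  simp [CountableMeasuring.sumEval]

theorem CountableMeasuring.isMeasuring_sumEval :
    IsMeasuring (CountableMeasuring.sumEval k T A) :=
  .of_lsingle fun i ↦ by
    rw [CountableMeasuring.sumEval_comp_lsingle]
    exact i.isMeasuring

/-- The largest coideal of the direct sum on which the measuring vanishes. -/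
noncomputable def CountableMeasuring.nullCoideal : Submodule k (CountableMeasuring.Sum k T A) :=
  sSup {I | I.IsCoideal ∧ ∀ x ∈ I, ∀ t : T, CountableMeasuring.sumEval k T A (x ⊗ₜ[k] t) = 0}

instance CountableMeasuring.isCoideal_nullCoideal :
    (CountableMeasuring.nullCoideal k T A).IsCoideal where
  counit_eq_zero := by
    suffices CountableMeasuring.nullCoideal k T A ≤ LinearMap.ker counit from this
    exact sSup_le fun I hI x hx ↦ hI.1.counit_eq_zero hx
  map_mkQ_comul_eq_zero := by
    suffices CountableMeasuring.nullCoideal k T A ≤ LinearMap.ker (TensorProduct.map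
        (CountableMeasuring.nullCoideal k T A).mkQ (CountableMeasuring.nullCoideal k T A).mkQ ∘ₗ
          comul) from this
    refine sSup_le fun I hI x hx ↦ ?_
    have hle : I ≤ CountableMeasuring.nullCoideal k T A := le_sSup hI
    have hfac : (CountableMeasuring.nullCoideal k T A).mkQ = Submodule.factor hle ∘ₗ I.mkQ := by
      ext; rfl
    rw [LinearMap.mem_ker, LinearMap.comp_apply, hfac, ← TensorProduct.map_map,
      hI.1.map_mkQ_comul_eq_zero hx, map_zero]

theorem CountableMeasuring.sumEval_eq_zero {x : CountableMeasuring.Sum k T A}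
    (hx : x ∈ CountableMeasuring.nullCoideal k T A) (t : T) :
    CountableMeasuring.sumEval k T A (x ⊗ₜ[k] t) = 0 := by
  suffices CountableMeasuring.nullCoideal k T A ≤
      LinearMap.ker ((TensorProduct.curry (CountableMeasuring.sumEval k T A)).flip t) from this hx
  exact sSup_le fun I hI x hx ↦ hI.2 x hx t

/-- Sweedler's universal measuring coalgebra `M(T, A)`: the direct sum of all countable-dimensional
coalgebras measuring `T` to `A`, modulo the largest coideal on which the measuring vanishes. -/
def MeasCoalg : Type (max u v w) :=
  CountableMeasuring.Sum k T A ⧸ CountableMeasuring.nullCoideal k T A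

namespace MeasCoalg

noncomputable instance : AddCommGroup (MeasCoalg k T A) :=
  inferInstanceAs (AddCommGroup (_ ⧸ CountableMeasuring.nullCoideal k T A))

noncomputable instance : Module k (MeasCoalg k T A) :=
  inferInstanceAs (Module k (_ ⧸ CountableMeasuring.nullCoideal k T A))

noncomputable instance : Coalgebra k (MeasCoalg k T A) :=
  inferInstanceAs (Coalgebra k (_ ⧸ CountableMeasuring.nullCoideal k T A))

/-- The projection of the direct sum of all countable measurings onto `M(T, A)`. -/
noncomputable def proj : CountableMeasuring.Sum k T A →ₗc[k] MeasCoalg k T A :=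
  Coalgebra.Quotient.mkQCoalgHom (CountableMeasuring.nullCoideal k T A)

theorem proj_surjective : Function.Surjective (proj k T A) :=
  Submodule.mkQ_surjective (CountableMeasuring.nullCoideal k T A)

theorem proj_eq_zero_iff {x : CountableMeasuring.Sum k T A} :
    proj k T A x = 0 ↔ x ∈ CountableMeasuring.nullCoideal k T A :=
  Submodule.Quotient.mk_eq_zero _

/-- The universal measuring `M(T, A) ⊗ T → A`. -/
noncomputable def eval : MeasCoalg k T A ⊗[k] T →ₗ[k] A :=
  TensorProduct.lift ((CountableMeasuring.nullCoideal k T A).liftQ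
    (TensorProduct.curry (CountableMeasuring.sumEval k T A)) fun _ hx ↦
      LinearMap.ext fun t ↦ CountableMeasuring.sumEval_eq_zero k T A hx t)

theorem eval_comp_proj :
    eval k T A ∘ₗ LinearMap.rTensor T (proj k T A : _ →ₗ[k] MeasCoalg k T A) =
      CountableMeasuring.sumEval k T A :=
  TensorProduct.ext' fun _ _ ↦ rfl

theorem isMeasuring_eval : IsMeasuring (eval k T A) :=
  .of_surjective (proj k T A) (proj_surjective k T A) <| by
    rw [eval_comp_proj]
    exact CountableMeasuring.isMeasuring_sumEval k T A

variable {k T A}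

/-- No nonzero coideal of `M(T, A)` is killed by the universal measuring. This makes coalgebra maps
into `M(T, A)` determined by the measurings they induce. -/
theorem eq_bot_of_isCoideal (K : Submodule k (MeasCoalg k T A)) [hK : K.IsCoideal]
    (h : ∀ x ∈ K, ∀ t : T, eval k T A (x ⊗ₜ[k] t) = 0) : K = ⊥ := by
  let p : CountableMeasuring.Sum k T A →ₗ[k] MeasCoalg k T A := proj k T A
  let I := K.comap p
  have hI : I.IsCoideal :=
    { counit_eq_zero := fun x hx ↦ by
        rw [← CoalgHomClass.counit_comp_apply (proj k T A) x]
        exact hK.counit_eq_zero hx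
      map_mkQ_comul_eq_zero := fun x hx ↦ by
        -- The quotient by the preimage of `K` embeds into the quotient by `K`.
        have hinj : Function.Injective (I.mapQ K p le_rfl) := by
          rw [← LinearMap.ker_eq_bot, Submodule.ker_mapQ]
          exact Submodule.mkQ_map_self I
        apply TensorProduct.map_injective_of_flat_flat _ _ hinj hinj
        have hcomp : I.mapQ K p le_rfl ∘ₗ I.mkQ = K.mkQ ∘ₗ p := rfl
        rw [TensorProduct.map_map, hcomp, ← TensorProduct.map_map, map_zero]
        exact (congrArg _ (CoalgHomClass.map_comp_comul_apply (proj k T A) x)).trans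
          (hK.map_mkQ_comul_eq_zero hx) }
  have hle : I ≤ CountableMeasuring.nullCoideal k T A := le_sSup ⟨hI, fun x hx t ↦ by
    rw [← eval_comp_proj]
    exact h _ hx t⟩
  rw [eq_bot_iff]
  intro y hy
  obtain ⟨x, rfl⟩ := proj_surjective k T A y
  exact (proj_eq_zero_iff k T A).2 (hle hy)

/-- A linear map into `M(T, A)` whose image is a coideal killed by the universal measuring
vanishes. -/
theorem eq_zero_of_range_isCoideal {C : Type*} [AddCommGroup C] [Module k C]
    (d : C →ₗ[k] MeasCoalg k T A) (hcounit : ∀ x, counit (R := k) (d x) = 0)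
    (hcomul : ∀ x, TensorProduct.map (LinearMap.range d).mkQ (LinearMap.range d).mkQ
      (comul (R := k) (d x)) = 0)
    (h : ∀ x (t : T), eval k T A (d x ⊗ₜ[k] t) = 0) : d = 0 := by
  have : (LinearMap.range d).IsCoideal :=
    { counit_eq_zero := by rintro _ ⟨x, rfl⟩; exact hcounit x
      map_mkQ_comul_eq_zero := by rintro _ ⟨x, rfl⟩; exact hcomul x }
  exact LinearMap.range_eq_bot.1
    (eq_bot_of_isCoideal _ (by rintro _ ⟨x, rfl⟩ t; exact h x t))

/-- Coalgebra maps into `M(T, A)` are equal if they induce the same measuring, since the image of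
the difference of two coalgebra maps is a coideal. -/
theorem hom_ext {C : Type*} [AddCommGroup C] [Module k C] [Coalgebra k C]
    {f g : C →ₗc[k] MeasCoalg k T A}
    (h : ∀ x (t : T), eval k T A (f x ⊗ₜ[k] t) = eval k T A (g x ⊗ₜ[k] t)) : f = g := by
  let d : C →ₗ[k] MeasCoalg k T A := (f : C →ₗ[k] _) - (g : C →ₗ[k] _)
  have hd : d = 0 := by
    refine eq_zero_of_range_isCoideal d (fun x ↦ ?_) (fun x ↦ ?_) fun x t ↦ ?_
    · simp [d]
    · have hq : (LinearMap.range d).mkQ ∘ₗ (f : C →ₗ[k] _) =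
          (LinearMap.range d).mkQ ∘ₗ (g : C →ₗ[k] _) := by
        refine LinearMap.ext fun y ↦ (Submodule.Quotient.eq _).2 ⟨y, rfl⟩
      have hdx : d x = f x - g x := rfl
      rw [hdx, map_sub, map_sub, ← CoalgHomClass.map_comp_comul_apply f x,
        ← CoalgHomClass.map_comp_comul_apply g x, sub_eq_zero]
      refine (TensorProduct.map_map ..).trans (Eq.trans ?_ (TensorProduct.map_map ..).symm)
      exact congrArg (fun e ↦ TensorProduct.map e e (comul (R := k) x)) hq
    · simp [d, TensorProduct.sub_tmul, h]
  ext x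
  exact sub_eq_zero.1 (LinearMap.congr_fun hd x)

end MeasCoalg

end Construction

/-! ### Coalgebras are unions of subcoalgebras of countable dimension -/

section Countable

open Coalgebra

theorem countable_setOf_reflTransGen {ι : Type*} {r : ι → ι → Prop}
    (h : ∀ i, {j | r i j}.Countable) (i : ι) : {j | Relation.ReflTransGen r i j}.Countable := by
  let step : Set ι → Set ι := fun s ↦ ⋃ a ∈ s, {j | r a j}
  have hcount : ∀ n, (step^[n] {i}).Countable := by
    intro n
    induction n with
    | zero => exact Set.countable_singleton i
    | succ n ih =>
      rw [Function.iterate_succ_apply']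
      exact ih.biUnion fun a _ ↦ h a
  refine (Set.countable_iUnion hcount).mono fun j hj ↦ ?_
  induction hj with
  | refl => exact Set.mem_iUnion.2 ⟨0, rfl⟩
  | tail _ hbc ih =>
    obtain ⟨n, hn⟩ := Set.mem_iUnion.1 ih
    refine Set.mem_iUnion.2 ⟨n + 1, ?_⟩
    rw [Function.iterate_succ_apply']
    exact Set.mem_biUnion hn hbc

variable {k C : Type*} [Field k] [AddCommGroup C] [Module k C] [Coalgebra k C] {ι : Type*}

/-- The basis vector `b j` occurs in `Δ (b i)`. -/
def Module.Basis.OccursInComul (b : Module.Basis ι k C) (i j : ι) : Prop :=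
  ∃ p ∈ ((b.tensorProduct b).repr (comul (b i))).support, p.1 = j ∨ p.2 = j

theorem Module.Basis.countable_occursInComul (b : Module.Basis ι k C) (i : ι) :
    {j | b.OccursInComul i j}.Countable := by
  let s := ((b.tensorProduct b).repr (comul (b i))).support
  have hs : ((Prod.fst '' (s : Set (ι × ι))) ∪ (Prod.snd '' (s : Set (ι × ι)))).Countable :=
    ((s.finite_toSet.image _).union (s.finite_toSet.image _)).countable
  refine hs.mono ?_
  rintro j ⟨p, hp, rfl | rfl⟩
  · exact Or.inl ⟨p, hp, rfl⟩
  · exact Or.inr ⟨p, hp, rfl⟩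

/-- The subcoalgebra of countable dimension spanned by the basis vectors that occur in iterated
comultiplications of `b i`. -/
def Module.Basis.reach (b : Module.Basis ι k C) (i : ι) : Submodule k C :=
  Submodule.span k (b '' {j | Relation.ReflTransGen b.OccursInComul i j})

theorem Module.Basis.mem_reach (b : Module.Basis ι k C) {i j : ι}
    (h : Relation.ReflTransGen b.OccursInComul i j) : b j ∈ b.reach i :=
  Submodule.subset_span ⟨j, h, rfl⟩

theorem Module.Basis.reach_le (b : Module.Basis ι k C) {i j : ι}
    (h : Relation.ReflTransGen b.OccursInComul i j) : b.reach j ≤ b.reach i :=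
  Submodule.span_mono (Set.image_mono fun _ h' ↦ h.trans h')

theorem Module.Basis.comul_mem_range_reach (b : Module.Basis ι k C) (i : ι)
    (x : SubspaceCarrier (b.reach i)) :
    comul (R := k) (SubspaceCarrier.incl _ x) ∈ LinearMap.range (TensorProduct.map
      (SubspaceCarrier.incl (b.reach i)) (SubspaceCarrier.incl (b.reach i))) := by
  suffices b.reach i ≤ (LinearMap.range (TensorProduct.map (SubspaceCarrier.incl (b.reach i))
      (SubspaceCarrier.incl (b.reach i)))).comap comul from this x.2
  refine Submodule.span_le.2 ?_
  rintro _ ⟨j, hj, rfl⟩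
  change comul (R := k) (b j) ∈ LinearMap.range _
  rw [← (b.tensorProduct b).linearCombination_repr (comul (b j)), Finsupp.linearCombination_apply]
  refine Submodule.sum_mem _ fun p hp ↦ Submodule.smul_mem _ _ ?_
  rw [Module.Basis.tensorProduct_apply']
  let x₁ : SubspaceCarrier (b.reach i) := ⟨b p.1, b.mem_reach (hj.tail ⟨p, hp, Or.inl rfl⟩)⟩
  let x₂ : SubspaceCarrier (b.reach i) := ⟨b p.2, b.mem_reach (hj.tail ⟨p, hp, Or.inr rfl⟩)⟩
  exact ⟨x₁ ⊗ₜ x₂, TensorProduct.map_tmul ..⟩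

theorem Module.Basis.exists_surjective_reach (b : Module.Basis ι k C) (i : ι) :
    ∃ σ : (ℕ →₀ k) →ₗ[k] SubspaceCarrier (b.reach i), Function.Surjective σ := by
  have hne : (b '' {j | Relation.ReflTransGen b.OccursInComul i j}).Nonempty :=
    ⟨b i, i, .refl, rfl⟩
  obtain ⟨e, he⟩ := ((countable_setOf_reflTransGen b.countable_occursInComul i).image
    b).exists_eq_range hne
  have hrange : LinearMap.range (Finsupp.linearCombination k e) = b.reach i := by
    rw [Finsupp.range_linearCombination, ← he, Module.Basis.reach]
  refine ⟨(Finsupp.linearCombination k e).codRestrict (b.reach i) fun x ↦ ?_, fun y ↦ ?_⟩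
  · rw [← hrange]
    exact ⟨x, rfl⟩
  · obtain ⟨x, hx⟩ : SubspaceCarrier.incl _ y ∈ LinearMap.range (Finsupp.linearCombination k e) := by
      rw [hrange]
      exact y.2
    exact ⟨x, Subtype.ext hx⟩

end Countable

/-! ### The universal property of the universal measuring coalgebra -/

namespace MeasCoalg

open Coalgebra

variable {k : Type u} {T : Type w} {A : Type v} [Field k] [Ring T] [Algebra k T] [Ring A]
  [Algebra k A]

/-- The coalgebra map to `M(T, A)` from one of the coalgebras used in its construction. -/
noncomputable def ofCountable (i : CountableMeasuring k T A) :
    CountableSpace i.subspace →ₗc[k] MeasCoalg k T A :=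
  (proj k T A).comp
    { DFinsupp.lsingle (M := fun i : CountableMeasuring k T A ↦ CountableSpace i.subspace) i with
      counit_comp := DFinsupp.counit_comp_lsingle ..
      map_comp_comul := (DFinsupp.comul_comp_lsingle ..).symm }

theorem eval_ofCountable (i : CountableMeasuring k T A) (x : CountableSpace i.subspace) (t : T) :
    eval k T A (ofCountable i x ⊗ₜ[k] t) = i.eval (x ⊗ₜ[k] t) := by
  have h := LinearMap.congr_fun (CountableMeasuring.sumEval_comp_lsingle k T A i) (x ⊗ₜ t)
  rw [← eval_comp_proj] at h
  exact h

/-- A coalgebra of countable dimension is isomorphic to one on a subspace of the finitely supported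
sequences, namely on a complement of the kernel of a surjection from these. -/
theorem exists_countableSpace_coalgEquiv {D : Type*} [AddCommGroup D] [Module k D] [Coalgebra k D]
    (σ : (ℕ →₀ k) →ₗ[k] D) (hσ : Function.Surjective σ) :
    ∃ (V : Submodule k (ℕ →₀ k)) (_ : Coalgebra k (CountableSpace V)),
      Nonempty (CountableSpace V ≃ₗc[k] D) := by
  obtain ⟨V, hV⟩ := (LinearMap.ker σ).exists_isCompl
  let e : CountableSpace V →ₗ[k] D := σ ∘ₗ CountableSpace.incl V
  have hinj : Function.Injective e := by
    rw [← LinearMap.ker_eq_bot, eq_bot_iff]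
    intro x hx
    exact Subtype.ext <| (Submodule.disjoint_def.1 hV.disjoint) x.1 hx x.2
  have hsurj : Function.Surjective e := by
    intro d
    obtain ⟨y, rfl⟩ := hσ d
    obtain ⟨z, hz, v, hv, rfl⟩ := Submodule.mem_sup.1
      (hV.codisjoint.eq_top ▸ Submodule.mem_top : y ∈ LinearMap.ker σ ⊔ V)
    refine ⟨(⟨v, hv⟩ : V), ?_⟩
    rw [map_add, LinearMap.mem_ker.1 hz, zero_add]
    rfl
  have hcomul : ∀ x, comul (R := k) (e x) ∈ LinearMap.range (TensorProduct.map e e) :=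
    fun x ↦ TensorProduct.map_surjective hsurj hsurj _
  let _ : Coalgebra k (CountableSpace V) := coalgebraOfInjective e hinj hcomul
  exact ⟨V, _, ⟨.ofBijective (f := coalgHomOfInjective e hinj hcomul) ⟨hinj, hsurj⟩⟩⟩

theorem exists_lift_of_countable {D : Type*} [AddCommGroup D] [Module k D] [Coalgebra k D]
    (σ : (ℕ →₀ k) →ₗ[k] D) (hσ : Function.Surjective σ) {ψ : D ⊗[k] T →ₗ[k] A}
    (hψ : IsMeasuring ψ) :
    ∃ f : D →ₗc[k] MeasCoalg k T A, ∀ x (t : T), eval k T A (f x ⊗ₜ[k] t) = ψ (x ⊗ₜ[k] t) := by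
  obtain ⟨V, _, ⟨E⟩⟩ := exists_countableSpace_coalgEquiv σ hσ
  have h : IsMeasuring (ψ ∘ₗ LinearMap.rTensor T (E.toCoalgHom : CountableSpace V →ₗ[k] D)) :=
    hψ.comp_coalgHom E.toCoalgHom
  let i : CountableMeasuring k T A :=
    { subspace := V, eval := _, isMeasuring := h }
  refine ⟨(ofCountable i).comp (E.symm : D →ₗc[k] CountableSpace V), fun x t ↦ ?_⟩
  refine (eval_ofCountable i (E.symm x) t).trans ?_
  exact congrArg (fun y ↦ ψ (y ⊗ₜ[k] t)) (E.apply_symm_apply x)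

/-- Every measuring by a coalgebra `C` is induced by a coalgebra map to `M(T, A)`: the maps on
subcoalgebras of countable dimension agree on overlaps. -/
theorem exists_lift {C : Type*} [AddCommGroup C] [Module k C] [Coalgebra k C]
    {ψ : C ⊗[k] T →ₗ[k] A} (hψ : IsMeasuring ψ) :
    ∃ f : C →ₗc[k] MeasCoalg k T A, ∀ x (t : T), eval k T A (f x ⊗ₜ[k] t) = ψ (x ⊗ₜ[k] t) := by
  let b := Module.Basis.ofVectorSpace k C
  let E i := SubspaceCarrier (b.reach i)
  let _ : ∀ i, Coalgebra k (E i) := fun i ↦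
    coalgebraOfInjective (SubspaceCarrier.incl (b.reach i)) (SubspaceCarrier.incl_injective _)
      (b.comul_mem_range_reach i)
  let j i : E i →ₗc[k] C := coalgHomOfInjective (SubspaceCarrier.incl (b.reach i))
    (SubspaceCarrier.incl_injective _) (b.comul_mem_range_reach i)
  have hj : ∀ i, Function.Injective (j i) := fun i ↦ SubspaceCarrier.incl_injective _
  have hf : ∀ i, ∃ f : E i →ₗc[k] MeasCoalg k T A,
      ∀ x (t : T), eval k T A (f x ⊗ₜ[k] t) = ψ (j i x ⊗ₜ[k] t) := fun i ↦ by
    obtain ⟨σ, hσ⟩ := b.exists_surjective_reach i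
    exact exists_lift_of_countable σ hσ (hψ.comp_coalgHom (j i))
  choose f hf using hf
  let v (i l) (h : Relation.ReflTransGen b.OccursInComul i l) : E i := ⟨b l, b.mem_reach h⟩
  let G : C →ₗ[k] MeasCoalg k T A := b.constr k fun i ↦ f i (v i i .refl)
  -- The lift on the subcoalgebra generated by `b l` is the restriction of any lift on a larger one.
  have hcompat : ∀ i l (h : Relation.ReflTransGen b.OccursInComul i l),
      f l (v l l .refl) = f i (v i l h) := by
    intro i l h
    let r : E l →ₗ[k] E i := Submodule.inclusion (b.reach_le h)
    let rc : E l →ₗc[k] E i :=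
      { r with
        counit_comp := rfl
        map_comp_comul := by
          ext x
          apply TensorProduct.map_injective_of_flat_flat _ _ (hj i) (hj i)
          refine (TensorProduct.map_map ..).trans ?_
          refine Eq.trans ?_ (CoalgHomClass.map_comp_comul_apply (j i) (r x)).symm
          exact CoalgHomClass.map_comp_comul_apply (j l) x }
    have : f l = (f i).comp rc := hom_ext fun x t ↦ by
      rw [hf l x t, CoalgHom.comp_apply, hf i]
      rfl
    rw [this]
    rfl
  have hG : ∀ i, G ∘ₗ (j i : E i →ₗ[k] C) = (f i : E i →ₗ[k] _) := by
    intro i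
    suffices H : ∀ x (hx : x ∈ b.reach i), G x = f i (⟨x, hx⟩ : b.reach i) from
      LinearMap.ext fun x ↦ H x.1 x.2
    intro x hx
    induction hx using Submodule.span_induction with
    | mem x h =>
      obtain ⟨l, hl, rfl⟩ := h
      exact (b.constr_basis k _ l).trans (hcompat i l hl)
    | zero => exact (map_zero G).trans (map_zero (f i)).symm
    | add x y hx hy h1 h2 =>
      rw [map_add, h1, h2]
      exact (map_add (f i) (⟨x, hx⟩ : b.reach i) (⟨y, hy⟩ : b.reach i)).symm
    | smul a x hx h =>
      rw [map_smul, h]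
      exact (map_smul (f i) a (⟨x, hx⟩ : b.reach i)).symm
  have hG' : ∀ i, G (b i) = f i (v i i .refl) := fun i ↦ b.constr_basis k _ i
  have hjv : ∀ i, j i (v i i .refl) = b i := fun i ↦ rfl
  refine ⟨{ G with
            counit_comp := b.ext fun i ↦ ?_
            map_comp_comul := b.ext fun i ↦ ?_ }, fun x t ↦ ?_⟩
  · change counit (G (b i)) = counit (b i)
    rw [hG', CoalgHomClass.counit_comp_apply (f i), ← hjv i, CoalgHomClass.counit_comp_apply (j i)]
  · change TensorProduct.map G G (comul (b i)) = comul (G (b i))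
    rw [hG', ← CoalgHomClass.map_comp_comul_apply (f i), ← hjv i,
      ← CoalgHomClass.map_comp_comul_apply (j i)]
    refine (TensorProduct.map_map ..).trans ?_
    exact congrArg (fun e ↦ TensorProduct.map e e (comul (R := k) (v i i .refl))) (hG i)
  · change eval k T A (G x ⊗ₜ t) = _
    suffices H : (TensorProduct.curry (eval k T A)).flip t ∘ₗ G = (TensorProduct.curry ψ).flip t from
      LinearMap.congr_fun H x
    refine b.ext fun i ↦ ?_
    change eval k T A (G (b i) ⊗ₜ t) = ψ (b i ⊗ₜ t)
    rw [hG', hf, hjv]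

/-- The coalgebra map to `M(T, A)` induced by a measuring. -/
noncomputable def lift {C : Type*} [AddCommGroup C] [Module k C] [Coalgebra k C]
    (ψ : C ⊗[k] T →ₗ[k] A) (hψ : IsMeasuring ψ) : C →ₗc[k] MeasCoalg k T A :=
  (exists_lift hψ).choose

theorem eval_lift {C : Type*} [AddCommGroup C] [Module k C] [Coalgebra k C]
    (ψ : C ⊗[k] T →ₗ[k] A) (hψ : IsMeasuring ψ) (x : C) (t : T) :
    eval k T A (lift ψ hψ x ⊗ₜ[k] t) = ψ (x ⊗ₜ[k] t) :=
  (exists_lift hψ).choose_spec x t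

end MeasCoalg

/-! ### The bialgebra structure -/

section ProductMeasuring

open Coalgebra

variable {k C D T A : Type*} [Field k] [AddCommGroup C] [Module k C] [Coalgebra k C]
  [AddCommGroup D] [Module k D] [Coalgebra k D] [Ring T] [Bialgebra k T] [CommRing A] [Algebra k A]

theorem sum_comm_four {α β γ δ M : Type*} [AddCommMonoid M] (s : Finset α) (t : Finset β)
    (u : Finset γ) (v : Finset δ) (f : α → β → γ → δ → M) :
    ∑ a ∈ s, ∑ b ∈ t, ∑ c ∈ u, ∑ d ∈ v, f a b c d =
      ∑ d ∈ v, ∑ c ∈ u, ∑ b ∈ t, ∑ a ∈ s, f a b c d := by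
  simp only [Finset.sum_comm (t := t)]
  simp only [Finset.sum_comm (t := u)]
  simp only [Finset.sum_comm (t := v)]

/-- The product `(c ⊗ d) ⊗ t ↦ ∑ ψ(c, t₁) φ(d, t₂)` of two linear maps `ψ : C ⊗ T → A` and
`φ : D ⊗ T → A`. -/
noncomputable def convProd (ψ : C ⊗[k] T →ₗ[k] A) (φ : D ⊗[k] T →ₗ[k] A) :
    (C ⊗[k] D) ⊗[k] T →ₗ[k] A :=
  LinearMap.mul' k A ∘ₗ TensorProduct.map ψ φ ∘ₗ
    (TensorProduct.tensorTensorTensorComm k C D T T).toLinearMap ∘ₗ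
      LinearMap.lTensor (C ⊗[k] D) comul

omit [Coalgebra k C] [Coalgebra k D] in
theorem convProd_tmul (ψ : C ⊗[k] T →ₗ[k] A) (φ : D ⊗[k] T →ₗ[k] A) (c : C) (d : D) (t : T)
    {ι : Type*} (r : Coalgebra.Repr k t ι) :
    convProd ψ φ ((c ⊗ₜ d) ⊗ₜ t) =
      ∑ i ∈ r.index, ψ (c ⊗ₜ r.left i) * φ (d ⊗ₜ r.right i) := by
  simp [convProd, ← r.eq, TensorProduct.tmul_sum]

omit [Coalgebra k C] [Coalgebra k D] in
/-- In terms of the convolution product on linear maps `T → A`, the product of two linear maps is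
computed slicewise. -/
theorem toConv_curry_convProd (ψ : C ⊗[k] T →ₗ[k] A) (φ : D ⊗[k] T →ₗ[k] A) (c : C) (d : D) :
    WithConv.toConv (TensorProduct.curry (convProd ψ φ) (c ⊗ₜ d)) =
      WithConv.toConv (TensorProduct.curry ψ c) * WithConv.toConv (TensorProduct.curry φ d) := by
  ext t
  rw [(ℛ k t).convMul_apply]
  exact convProd_tmul ψ φ c d t (ℛ k t)

/-- The product of two measurings is a measuring. This uses that `A` is commutative. -/
theorem IsMeasuring.convProd {ψ : C ⊗[k] T →ₗ[k] A} {φ : D ⊗[k] T →ₗ[k] A} (hψ : IsMeasuring ψ)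
    (hφ : IsMeasuring φ) : IsMeasuring (convProd ψ φ) where
  map_mul x t t' := by
    suffices H : (TensorProduct.curry (_root_.convProd ψ φ)).flip (t * t') =
        LinearMap.mul' k A ∘ₗ TensorProduct.map ((TensorProduct.curry (_root_.convProd ψ φ)).flip t)
          ((TensorProduct.curry (_root_.convProd ψ φ)).flip t') ∘ₗ comul from
      LinearMap.congr_fun H x
    refine TensorProduct.ext' fun c d ↦ ?_
    let r := ℛ k t
    let r' := ℛ k t'
    have hr : ∑ p ∈ r.index ×ˢ r'.index,
        (r.left p.1 * r'.left p.2) ⊗ₜ[k] (r.right p.1 * r'.right p.2) = comul (t * t') := by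
      rw [Bialgebra.comul_mul, ← r.eq, ← r'.eq, Finset.sum_mul_sum, Finset.sum_product]
      simp
    let rr : Coalgebra.Repr k (t * t') ((T × T) × (T × T)) := ⟨_, _, _, hr⟩
    have lhs := convProd_tmul ψ φ c d (t * t') rr
    simp only [LinearMap.flip_apply, TensorProduct.curry_apply, LinearMap.comp_apply, lhs, rr,
      TensorProduct.comul_tmul]
    simp only [Finset.sum_product, hψ.map_mul_repr (ℛ k c), hφ.map_mul_repr (ℛ k d)]
    conv_rhs => rw [← (ℛ k c).eq, ← (ℛ k d).eq]
    simp only [TensorProduct.sum_tmul, TensorProduct.tmul_sum, map_sum,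
      TensorProduct.AlgebraTensorModule.tensorTensorTensorComm_tmul, TensorProduct.map_tmul,
      LinearMap.mul'_apply, LinearMap.flip_apply, TensorProduct.curry_apply,
      convProd_tmul ψ φ _ _ t r, convProd_tmul ψ φ _ _ t' r', Finset.sum_mul_sum]
    rw [sum_comm_four]
    refine Finset.sum_congr rfl fun _ _ ↦ Finset.sum_congr rfl fun _ _ ↦
      Finset.sum_congr rfl fun _ _ ↦ Finset.sum_congr rfl fun _ _ ↦ ?_
    rw [mul_mul_mul_comm]
  map_one x := by
    suffices H : (TensorProduct.curry (_root_.convProd ψ φ)).flip 1 =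
        Algebra.linearMap k A ∘ₗ counit from LinearMap.congr_fun H x
    refine TensorProduct.ext' fun c d ↦ ?_
    let r : Coalgebra.Repr k (1 : T) Unit :=
      ⟨{()}, fun _ ↦ 1, fun _ ↦ 1, by simp [Algebra.TensorProduct.one_def]⟩
    have := convProd_tmul ψ φ c d 1 r
    simp [r, hψ.map_one, hφ.map_one] at this
    simp [this, mul_comm]

end ProductMeasuring

namespace MeasCoalg

open Coalgebra WithConv

variable {k : Type u} {T : Type w} {A : Type v} [Field k] [Ring T] [Bialgebra k T] [CommRing A]
  [Algebra k A]

variable (k T A) in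
/-- The linear map `T → A` given by an element of `M(T, A)`, as an element of the convolution
algebra. -/
noncomputable def toFun : MeasCoalg k T A →ₗ[k] WithConv (T →ₗ[k] A) :=
  (WithConv.linearEquiv k (T →ₗ[k] A)).symm.toLinearMap ∘ₗ TensorProduct.curry (eval k T A)

theorem toFun_apply (m : MeasCoalg k T A) (t : T) : toFun k T A m t = eval k T A (m ⊗ₜ t) := rfl

theorem hom_ext_toFun {C : Type*} [AddCommGroup C] [Module k C] [Coalgebra k C]
    {f g : C →ₗc[k] MeasCoalg k T A}
    (h : toFun k T A ∘ₗ (f : C →ₗ[k] _) = toFun k T A ∘ₗ (g : C →ₗ[k] _)) : f = g :=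
  hom_ext fun x t ↦ congrArg (fun (e : WithConv (T →ₗ[k] A)) ↦ e t) (LinearMap.congr_fun h x)

variable (k T A) in
/-- The multiplication of `M(T, A)`, as a coalgebra map. -/
noncomputable def mulHom : MeasCoalg k T A ⊗[k] MeasCoalg k T A →ₗc[k] MeasCoalg k T A :=
  lift (convProd (eval k T A) (eval k T A))
    ((isMeasuring_eval k T A).convProd (isMeasuring_eval k T A))

theorem toFun_mulHom (m m' : MeasCoalg k T A) :
    toFun k T A (mulHom k T A (m ⊗ₜ m')) = toFun k T A m * toFun k T A m' := by
  refine Eq.trans ?_ (toConv_curry_convProd _ _ m m')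
  refine congrArg toConv (LinearMap.ext fun t ↦ ?_)
  exact eval_lift ..

/-- The counit of `T`, as a measuring by the trivial coalgebra. -/
theorem isMeasuring_counit : IsMeasuring
    (Algebra.linearMap k A ∘ₗ counit ∘ₗ (TensorProduct.lid k T).toLinearMap) where
  map_mul c b b' := by simp [Algebra.smul_def, mul_left_comm]
  map_one c := by simp

variable (k T A) in
/-- The unit of `M(T, A)`, as a coalgebra map. -/
noncomputable def oneHom : k →ₗc[k] MeasCoalg k T A := lift _ isMeasuring_counit

theorem toFun_oneHom : toFun k T A (oneHom k T A 1) = 1 := by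
  refine congrArg toConv (LinearMap.ext fun t ↦ ?_)
  refine (eval_lift ..).trans ?_
  simp

noncomputable instance : Mul (MeasCoalg k T A) := ⟨fun m m' ↦ mulHom k T A (m ⊗ₜ m')⟩

noncomputable instance : One (MeasCoalg k T A) := ⟨oneHom k T A 1⟩

theorem mul_def (m m' : MeasCoalg k T A) : m * m' = mulHom k T A (m ⊗ₜ m') := rfl

theorem one_def : (1 : MeasCoalg k T A) = oneHom k T A 1 := rfl

theorem toFun_mul (m m' : MeasCoalg k T A) :
    toFun k T A (m * m') = toFun k T A m * toFun k T A m' := toFun_mulHom m m'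

theorem toFun_one : toFun k T A 1 = 1 := toFun_oneHom

theorem mulHom_assoc : (mulHom k T A).comp (CoalgHom.rTensor _ (mulHom k T A)) =
    (mulHom k T A).comp ((CoalgHom.lTensor _ (mulHom k T A)).comp
      (Coalgebra.TensorProduct.assoc k k (MeasCoalg k T A) (MeasCoalg k T A)
        (MeasCoalg k T A) : _ →ₗc[k] _)) := by
  refine hom_ext_toFun (TensorProduct.ext_threefold fun x y z ↦ ?_)
  change toFun k T A (x * y * z) = toFun k T A (x * (y * z))
  simp only [toFun_mul, mul_assoc]

theorem mulHom_oneHom_left : (mulHom k T A).comp (CoalgHom.rTensor _ (oneHom k T A)) =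
    (Coalgebra.TensorProduct.lid k (MeasCoalg k T A) : _ →ₗc[k] _) := by
  refine hom_ext_toFun (TensorProduct.ext' fun c x ↦ ?_)
  have hc : c = c • (1 : k) := by simp
  have : oneHom k T A c = c • 1 := by rw [one_def, ← map_smul, ← hc]
  change toFun k T A (oneHom k T A c * x) = toFun k T A (c • x)
  rw [toFun_mul, this, map_smul, map_smul, toFun_one, smul_mul_assoc, one_mul]

theorem mulHom_oneHom_right : (mulHom k T A).comp (CoalgHom.lTensor _ (oneHom k T A)) =
    (Coalgebra.TensorProduct.rid k k (MeasCoalg k T A) : _ →ₗc[k] _) := by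
  refine hom_ext_toFun (TensorProduct.ext' fun x c ↦ ?_)
  have hc : c = c • (1 : k) := by simp
  have : oneHom k T A c = c • 1 := by rw [one_def, ← map_smul, ← hc]
  change toFun k T A (x * oneHom k T A c) = toFun k T A (c • x)
  rw [toFun_mul, this, map_smul, map_smul, toFun_one, mul_smul_comm, mul_one]

noncomputable instance : Ring (MeasCoalg k T A) where
  __ := (inferInstance : AddCommGroup (MeasCoalg k T A))
  left_distrib a b c := by simp only [mul_def, TensorProduct.tmul_add, map_add]
  right_distrib a b c := by simp only [mul_def, TensorProduct.add_tmul, map_add]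
  zero_mul a := by simp only [mul_def, TensorProduct.zero_tmul, map_zero]
  mul_zero a := by simp only [mul_def, TensorProduct.tmul_zero, map_zero]
  mul_assoc a b c := DFunLike.congr_fun mulHom_assoc ((a ⊗ₜ b) ⊗ₜ c)
  one_mul a := by
    have := DFunLike.congr_fun (mulHom_oneHom_left (k := k) (T := T) (A := A)) (1 ⊗ₜ a)
    exact this.trans (one_smul k a)
  mul_one a := by
    have := DFunLike.congr_fun (mulHom_oneHom_right (k := k) (T := T) (A := A)) (a ⊗ₜ 1)
    exact this.trans (one_smul k a)

noncomputable instance : Algebra k (MeasCoalg k T A) :=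
  .ofModule (fun c a b ↦ by simp only [mul_def, ← TensorProduct.smul_tmul', map_smul])
    (fun c a b ↦ by simp only [mul_def, TensorProduct.tmul_smul, map_smul])

noncomputable instance : Bialgebra k (MeasCoalg k T A) :=
  .mk' k (MeasCoalg k T A)
    ((CoalgHomClass.counit_comp_apply (oneHom k T A) 1).trans (CommSemiring.counit_apply k 1))
    (fun {a b} ↦ by
      refine (CoalgHomClass.counit_comp_apply (mulHom k T A) (a ⊗ₜ b)).trans ?_
      rw [TensorProduct.counit_tmul, smul_eq_mul, mul_comm])
    (by
      refine (CoalgHomClass.map_comp_comul_apply (oneHom k T A) 1).symm.trans ?_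
      rw [CommSemiring.comul_apply]
      rfl)
    (fun {a b} ↦ by
      refine (CoalgHomClass.map_comp_comul_apply (mulHom k T A) (a ⊗ₜ b)).symm.trans ?_
      rw [TensorProduct.comul_tmul, ← (ℛ k a).eq, ← (ℛ k b).eq, Finset.sum_mul_sum]
      simp only [TensorProduct.sum_tmul, TensorProduct.tmul_sum, map_sum,
        TensorProduct.AlgebraTensorModule.tensorTensorTensorComm_tmul, TensorProduct.map_tmul,
        Algebra.TensorProduct.tmul_mul_tmul, mul_def]
      exact Finset.sum_comm)

variable (k T A) in
/-- The universal measuring `M(T, A) ⊗ T → A` is a bimeasuring. -/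
theorem isBimeasuring_eval : IsBimeasuring (eval k T A) where
  left := isMeasuring_eval k T A
  right :=
    { map_mul := fun t m m' ↦ congrArg (fun (e : WithConv (T →ₗ[k] A)) ↦ e t) (toFun_mul m m')
      map_one := fun t ↦ congrArg (fun (e : WithConv (T →ₗ[k] A)) ↦ e t)
        (toFun_one (k := k) (T := T) (A := A)) }

end MeasCoalg

/-! ### The universal bimeasuring -/

section MulCoalgHom

open Coalgebra

/-- The multiplication of a bialgebra, as a coalgebra map. -/
noncomputable def mulCoalgHom (k N : Type*) [Field k] [Ring N] [Bialgebra k N] :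
    N ⊗[k] N →ₗc[k] N where
  __ := LinearMap.mul' k N
  counit_comp := TensorProduct.ext' fun x y ↦ by simp [mul_comm]
  map_comp_comul := TensorProduct.ext' fun x y ↦ by
    change TensorProduct.map (LinearMap.mul' k N) (LinearMap.mul' k N) (comul (x ⊗ₜ y)) =
      comul (x * y)
    rw [TensorProduct.comul_tmul, Bialgebra.comul_mul, ← (ℛ k x).eq, ← (ℛ k y).eq,
      Finset.sum_mul_sum]
    simp only [TensorProduct.sum_tmul, TensorProduct.tmul_sum, map_sum,
      TensorProduct.AlgebraTensorModule.tensorTensorTensorComm_tmul, TensorProduct.map_tmul,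
      Algebra.TensorProduct.tmul_mul_tmul, LinearMap.mul'_apply]
    exact Finset.sum_comm

end MulCoalgHom

namespace MeasCoalg

open Coalgebra WithConv

variable {k : Type u} {T : Type w} {A : Type v} [Field k] [Ring T] [Bialgebra k T] [CommRing A]
  [Algebra k A] {N : Type*} [Ring N] [Bialgebra k N]

theorem toFun_lift {ψ : N ⊗[k] T →ₗ[k] A} (hψ : IsMeasuring ψ) (n : N) :
    toFun k T A (lift ψ hψ n) = toConv (TensorProduct.curry ψ n) :=
  congrArg toConv (LinearMap.ext fun t ↦ eval_lift ψ hψ n t)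

/-- The coalgebra map to `M(T, A)` induced by a bimeasuring is a bialgebra map. -/
noncomputable def liftBialgHom (ψ : N ⊗[k] T →ₗ[k] A) (hψ : IsBimeasuring ψ) :
    N →ₐc[k] MeasCoalg k T A where
  __ := lift ψ hψ.left
  map_one' := by
    let unit : k →ₗc[k] N := (Bialgebra.unitBialgHom k N : k →ₗc[k] N)
    have hunit : unit 1 = 1 := map_one (Bialgebra.unitBialgHom k N)
    have h : (lift ψ hψ.left).comp unit = oneHom k T A := hom_ext_toFun <| LinearMap.ext_ring <| by
      change toFun k T A (lift ψ hψ.left (unit 1)) = toFun k T A 1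
      rw [hunit, toFun_lift, toFun_one]
      exact congrArg toConv (LinearMap.ext hψ.right.map_one)
    have h1 := DFunLike.congr_fun h 1
    rw [CoalgHom.comp_apply, hunit] at h1
    exact h1
  map_mul' n n' := by
    have h : (lift ψ hψ.left).comp (mulCoalgHom k N) =
        (mulHom k T A).comp (Coalgebra.TensorProduct.map (lift ψ hψ.left) (lift ψ hψ.left)) :=
      hom_ext_toFun <| TensorProduct.ext' fun x y ↦ by
        change toFun k T A (lift ψ hψ.left (x * y)) =
          toFun k T A (lift ψ hψ.left x * lift ψ hψ.left y)
        rw [toFun_mul, toFun_lift, toFun_lift, toFun_lift]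
        exact congrArg toConv (LinearMap.ext fun t ↦ hψ.right.map_mul t x y)
    exact DFunLike.congr_fun h (n ⊗ₜ n')

theorem eval_liftBialgHom (ψ : N ⊗[k] T →ₗ[k] A) (hψ : IsBimeasuring ψ) (n : N) (t : T) :
    eval k T A (liftBialgHom ψ hψ n ⊗ₜ t) = ψ (n ⊗ₜ t) :=
  eval_lift ψ hψ.left n t

theorem bialgHom_ext {f g : N →ₐc[k] MeasCoalg k T A}
    (h : ∀ x (t : T), eval k T A (f x ⊗ₜ[k] t) = eval k T A (g x ⊗ₜ[k] t)) : f = g := by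
  have : (f : N →ₗc[k] MeasCoalg k T A) = (g : N →ₗc[k] MeasCoalg k T A) := hom_ext h
  exact DFunLike.ext _ _ fun x ↦ DFunLike.congr_fun this x

theorem isUniversalBimeasuring_eval {k : Type u} {T : Type w} {A : Type v} [Field k] [Ring T]
    [Bialgebra k T] [CommRing A] [Algebra k A] :
    IsUniversalBimeasuring (k := k) (B := MeasCoalg k T A) (eval k T A) where
  isBimeasuring := isBimeasuring_eval k T A
  existsUnique_lift N _ _ f hf := by
    refine ⟨liftBialgHom f hf, TensorProduct.ext' fun n t ↦ (eval_liftBialgHom f hf n t).symm,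
      fun g hg ↦ bialgHom_ext fun n t ↦ ?_⟩
    rw [eval_liftBialgHom, hg]
    rfl

end MeasCoalg

/-! ### The antipode -/

section Convolution

open Coalgebra

variable {k C P : Type*} [Field k] [AddCommGroup C] [Module k C] [Coalgebra k C]
  [AddCommGroup P] [Module k P]

/-- The map `a ⊗ b ⊗ c ↦ ∑ G(b, c₁) ⊗ G(a, c₂)`. -/
noncomputable def nested (G : C ⊗[k] C →ₗ[k] P) : C ⊗[k] (C ⊗[k] C) →ₗ[k] P ⊗[k] P :=
  TensorProduct.map G G ∘ₗ (TensorProduct.leftComm k C (C ⊗[k] C) C).toLinearMap ∘ₗ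
    LinearMap.lTensor C ((TensorProduct.assoc k C C C).symm.toLinearMap ∘ₗ LinearMap.lTensor C comul)

theorem nested_tmul_comul {G : C ⊗[k] C →ₗ[k] P} {p : P}
    (hG : ∀ c, G (comul (R := k) c) = counit (R := k) c • p) (a c : C) :
    nested G (a ⊗ₜ comul c) = p ⊗ₜ G (a ⊗ₜ c) := by
  have : nested G (a ⊗ₜ comul c) =
      TensorProduct.map G G (TensorProduct.leftComm k C (C ⊗[k] C) C
        (a ⊗ₜ (comul (R := k) (A := C)).rTensor C (comul c))) := by
    rw [← coassoc_symm_apply]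
    rfl
  rw [this, ← (ℛ k c).eq]
  conv_rhs => rw [← sum_counit_smul (ℛ k c)]
  simp [TensorProduct.tmul_sum, hG, TensorProduct.smul_tmul]

/-- If `∑ G(c₁, c₂) = ε(c) p`, then `∑ G(c₂, c₃) ⊗ G(c₁, c₄) = ε(c) p ⊗ p`. -/
theorem nested_assoc_comul {G : C ⊗[k] C →ₗ[k] P} {p : P}
    (hG : ∀ c, G (comul (R := k) c) = counit (R := k) c • p) (c : C) :
    nested G (TensorProduct.assoc k C C C ((comul (R := k) (A := C)).rTensor C (comul c))) =
      counit (R := k) c • (p ⊗ₜ[k] p) := by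
  rw [coassoc_apply, ← TensorProduct.tmul_smul, ← hG, ← (ℛ k c).eq]
  simp [nested_tmul_comul hG, TensorProduct.tmul_sum]

end Convolution

section Cop

open Coalgebra

/-- The co-opposite of a coalgebra, with the factors of the comultiplication exchanged. -/
def Cop (C : Type*) : Type _ := C

variable {k C : Type*} [Field k] [AddCommGroup C] [Module k C]

instance : AddCommGroup (Cop C) := inferInstanceAs (AddCommGroup C)

instance : Module k (Cop C) := inferInstanceAs (Module k C)

variable [Coalgebra k C]

/-- The comultiplication of the co-opposite coalgebra. -/
noncomputable def copComul (k C : Type*) [Field k] [AddCommGroup C] [Module k C] [Coalgebra k C] :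
    C →ₗ[k] C ⊗[k] C :=
  (TensorProduct.comm k C C).toLinearMap ∘ₗ comul

theorem copComul_coassoc :
    TensorProduct.assoc k C C C ∘ₗ (copComul k C).rTensor C ∘ₗ copComul k C =
      (copComul k C).lTensor C ∘ₗ copComul k C := by
  -- Both sides are the reversals of the two sides of the coassociativity law of `C`.
  let rev : C ⊗[k] (C ⊗[k] C) →ₗ[k] C ⊗[k] (C ⊗[k] C) :=
    (TensorProduct.assoc k C C C).toLinearMap ∘ₗ (TensorProduct.comm k C (C ⊗[k] C)).toLinearMap ∘ₗ
      LinearMap.lTensor C (TensorProduct.comm k C C).toLinearMap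
  have hl : (TensorProduct.assoc k C C C).toLinearMap ∘ₗ (copComul k C).rTensor C ∘ₗ
      (TensorProduct.comm k C C).toLinearMap = rev ∘ₗ (comul (R := k) (A := C)).lTensor C :=
    TensorProduct.ext' fun x y ↦ rfl
  have hr : (copComul k C).lTensor C ∘ₗ (TensorProduct.comm k C C).toLinearMap =
      rev ∘ₗ (TensorProduct.assoc k C C C).toLinearMap ∘ₗ (comul (R := k) (A := C)).rTensor C :=
    TensorProduct.ext' fun x y ↦ by
      simp only [LinearMap.comp_apply, LinearEquiv.coe_coe, TensorProduct.comm_tmul,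
        LinearMap.lTensor_tmul, LinearMap.rTensor_tmul, copComul, ← (ℛ k x).eq]
      simp [rev, TensorProduct.sum_tmul, TensorProduct.tmul_sum]
  ext c
  exact (LinearMap.congr_fun hl (comul c)).trans <|
    (congrArg rev (coassoc_apply c).symm).trans (LinearMap.congr_fun hr (comul c)).symm

theorem copComul_counit_left :
    (counit : C →ₗ[k] k).rTensor C ∘ₗ copComul k C = TensorProduct.mk k _ _ 1 := by
  have h : (counit : C →ₗ[k] k).rTensor C ∘ₗ (TensorProduct.comm k C C).toLinearMap =
      (TensorProduct.comm k C k).toLinearMap ∘ₗ (counit : C →ₗ[k] k).lTensor C :=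
    TensorProduct.ext' fun x y ↦ rfl
  ext c
  refine (LinearMap.congr_fun h (comul c)).trans ?_
  simp

theorem copComul_counit_right :
    (counit : C →ₗ[k] k).lTensor C ∘ₗ copComul k C = (TensorProduct.mk k _ _).flip 1 := by
  have h : (counit : C →ₗ[k] k).lTensor C ∘ₗ (TensorProduct.comm k C C).toLinearMap =
      (TensorProduct.comm k k C).toLinearMap ∘ₗ (counit : C →ₗ[k] k).rTensor C :=
    TensorProduct.ext' fun x y ↦ rfl
  ext c
  refine (LinearMap.congr_fun h (comul c)).trans ?_
  simp

noncomputable instance : Coalgebra k (Cop C) where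
  comul := copComul k C
  counit := (counit : C →ₗ[k] k)
  coassoc := copComul_coassoc (k := k) (C := C)
  rTensor_counit_comp_comul := copComul_counit_left (k := k) (C := C)
  lTensor_counit_comp_comul := copComul_counit_right (k := k) (C := C)

end Cop

section CopEquiv

/-- The identity map from a coalgebra to its co-opposite. -/
noncomputable def Cop.of (k C : Type*) [Field k] [AddCommGroup C] [Module k C] : C ≃ₗ[k] Cop C :=
  LinearEquiv.refl k C

end CopEquiv

namespace MeasCoalg

open Coalgebra WithConv

variable {k : Type u} {T : Type w} {A : Type v} [Field k] [Ring T] [HopfAlgebra k T] [CommRing A]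
  [Algebra k A]

variable (k T A) in
/-- The map `m ⊗ t ↦ θ(m, S t)`. -/
noncomputable def evalAntipode : Cop (MeasCoalg k T A) ⊗[k] T →ₗ[k] A :=
  eval k T A ∘ₗ TensorProduct.map (Cop.of k (MeasCoalg k T A)).symm.toLinearMap
    (HopfAlgebra.antipode k)

/-- Since the antipode of `T` reverses products and `A` is commutative, `m ⊗ t ↦ θ(m, S t)` is a
measuring by the co-opposite coalgebra. -/
theorem isMeasuring_evalAntipode : IsMeasuring (evalAntipode k T A) where
  map_mul m t t' := by
    let m' : MeasCoalg k T A := (Cop.of k _).symm m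
    have h := (isMeasuring_eval k T A).map_mul_repr (ℛ k m')
      (HopfAlgebra.antipode k t') (HopfAlgebra.antipode k t)
    have hl : evalAntipode k T A (m ⊗ₜ[k] (t * t')) = eval k T A (m' ⊗ₜ[k]
        (HopfAlgebra.antipode k t' * HopfAlgebra.antipode k t)) := by
      rw [← HopfAlgebra.antipode_mul_antidistrib]
      rfl
    have hm : copComul k (MeasCoalg k T A) m' =
        ∑ i ∈ (ℛ k m').index, (ℛ k m').right i ⊗ₜ[k] (ℛ k m').left i := by
      rw [copComul, LinearMap.comp_apply, ← (ℛ k m').eq]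
      simp
    rw [hl, h]
    refine Eq.trans ?_ (congrArg (fun y : Cop (MeasCoalg k T A) ⊗[k] Cop (MeasCoalg k T A) ↦
      LinearMap.mul' k A (TensorProduct.map ((TensorProduct.curry (evalAntipode k T A)).flip t)
        ((TensorProduct.curry (evalAntipode k T A)).flip t') y)) hm.symm)
    refine Eq.trans ?_ (map_sum (LinearMap.mul' k A ∘ₗ
      TensorProduct.map ((TensorProduct.curry (evalAntipode k T A)).flip t)
        ((TensorProduct.curry (evalAntipode k T A)).flip t')) _ _).symm
    exact Finset.sum_congr rfl fun i _ ↦ mul_comm _ _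
  map_one m := by
    have h := (isMeasuring_eval k T A).map_one ((Cop.of k _).symm m)
    rw [← HopfAlgebra.antipode_one (R := k)] at h
    exact h

variable (k T A) in
/-- The antipode of `M(T, A)`, characterized by `θ(S m, t) = θ(m, S t)`. -/
noncomputable def antipode : MeasCoalg k T A →ₗ[k] MeasCoalg k T A :=
  (lift (evalAntipode k T A) isMeasuring_evalAntipode : _ →ₗ[k] MeasCoalg k T A) ∘ₗ
    (Cop.of k (MeasCoalg k T A)).toLinearMap

theorem eval_antipode (m : MeasCoalg k T A) (t : T) :
    eval k T A (antipode k T A m ⊗ₜ t) = eval k T A (m ⊗ₜ HopfAlgebra.antipode k t) :=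
  eval_lift (evalAntipode k T A) isMeasuring_evalAntipode (Cop.of k _ m) t

theorem counit_antipode (m : MeasCoalg k T A) :
    counit (R := k) (antipode k T A m) = counit (R := k) m :=
  CoalgHomClass.counit_comp_apply (lift (evalAntipode k T A) isMeasuring_evalAntipode)
    (Cop.of k _ m)

theorem comul_antipode (m : MeasCoalg k T A) :
    comul (R := k) (antipode k T A m) = TensorProduct.map (antipode k T A) (antipode k T A)
      (TensorProduct.comm k _ _ (comul (R := k) m)) :=
  (CoalgHomClass.map_comp_comul_apply (lift (evalAntipode k T A) isMeasuring_evalAntipode)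
    (Cop.of k _ m)).symm

theorem comul_antipode_repr (m : MeasCoalg k T A) {ι : Type*} (r : Coalgebra.Repr k m ι) :
    comul (R := k) (antipode k T A m) =
      ∑ i ∈ r.index, antipode k T A (r.right i) ⊗ₜ[k] antipode k T A (r.left i) := by
  rw [comul_antipode, ← r.eq]
  simp

theorem comul_antipode_mul {P : Type*} [AddCommGroup P] [Module k P]
    (q : MeasCoalg k T A →ₗ[k] P) (x : MeasCoalg k T A ⊗[k] MeasCoalg k T A) :
    TensorProduct.map q q (comul (R := k)
        (LinearMap.mul' k _ ((antipode k T A).rTensor _ x))) =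
      nested (q ∘ₗ LinearMap.mul' k _ ∘ₗ (antipode k T A).rTensor _)
        (TensorProduct.assoc k _ _ _ (comul.rTensor _ x)) := by
  induction x with
  | zero => simp
  | add x y hx hy => simp only [map_add, hx, hy]
  | tmul a b =>
    simp only [LinearMap.rTensor_tmul, LinearMap.mul'_apply, Bialgebra.comul_mul,
      comul_antipode_repr a (ℛ k a)]
    simp only [← (ℛ k a).eq]
    simp only [← (ℛ k b).eq, nested, LinearMap.comp_apply]
    simp [TensorProduct.sum_tmul, TensorProduct.tmul_sum, Finset.sum_mul_sum, ← (ℛ k b).eq]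

theorem comul_mul_antipode {P : Type*} [AddCommGroup P] [Module k P]
    (q : MeasCoalg k T A →ₗ[k] P) (x : MeasCoalg k T A ⊗[k] MeasCoalg k T A) :
    TensorProduct.comm k P P (TensorProduct.map q q (comul (R := k)
        (LinearMap.mul' k _ ((antipode k T A).lTensor _ x)))) =
      nested (q ∘ₗ LinearMap.mul' k _ ∘ₗ (antipode k T A).lTensor _)
        (TensorProduct.assoc k _ _ _ (comul.rTensor _ x)) := by
  induction x with
  | zero => simp
  | add x y hx hy => simp only [map_add, hx, hy]
  | tmul a b =>
    simp only [LinearMap.lTensor_tmul, LinearMap.rTensor_tmul, LinearMap.mul'_apply,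
      Bialgebra.comul_mul, comul_antipode_repr b (ℛ k b)]
    simp only [← (ℛ k a).eq]
    simp only [nested, LinearMap.comp_apply]
    simp [TensorProduct.sum_tmul, TensorProduct.tmul_sum, Finset.sum_mul_sum, ← (ℛ k b).eq]

/-- A linear endomorphism `m ↦ ∑ S(m₁) m₂` or `m ↦ ∑ m₁ S(m₂)` agrees with the counit, as soon as
its comultiplication is nested and it induces the trivial measuring: the image of the difference
is then a coideal killed by the universal measuring. -/
theorem comp_comul_eq_counit
    (G : MeasCoalg k T A ⊗[k] MeasCoalg k T A →ₗ[k] MeasCoalg k T A)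
    (hcounit : ∀ x y, counit (R := k) (G (x ⊗ₜ y)) = counit (R := k) x * counit (R := k) y)
    (hcomul : ∀ m (q : MeasCoalg k T A →ₗ[k] MeasCoalg k T A ⧸
        LinearMap.range (G ∘ₗ comul - Algebra.linearMap k _ ∘ₗ counit)),
      nested (q ∘ₗ G) (TensorProduct.assoc k _ _ _ (comul.rTensor _ (comul m))) =
        counit (R := k) m • (q 1 ⊗ₜ[k] q 1) →
      TensorProduct.map q q (comul (R := k) (G (comul m))) =
        counit (R := k) m • (q 1 ⊗ₜ[k] q 1))
    (heval : ∀ m t, eval k T A (G (comul m) ⊗ₜ t) =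
      algebraMap k A (counit (R := k) m * counit (R := k) t)) :
    G ∘ₗ comul = Algebra.linearMap k _ ∘ₗ counit := by
  refine sub_eq_zero.1 (eq_zero_of_range_isCoideal _ (fun m ↦ ?_) (fun m ↦ ?_) fun m t ↦ ?_)
  · rw [LinearMap.sub_apply, map_sub, sub_eq_zero]
    simp only [LinearMap.comp_apply, Algebra.linearMap_apply, Bialgebra.counit_algebraMap]
    conv_rhs => rw [← sum_counit_smul (ℛ k m)]
    rw [← (ℛ k m).eq]
    simp [hcounit]
  · set q := (LinearMap.range (G ∘ₗ comul - Algebra.linearMap k _ ∘ₗ counit)).mkQ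
    have hq : ∀ c, (q ∘ₗ G) (comul (R := k) c) = counit (R := k) c • q 1 := fun c ↦ by
      rw [← map_smul, LinearMap.comp_apply, ← Algebra.algebraMap_eq_smul_one]
      exact (Submodule.Quotient.eq _).2 ⟨c, rfl⟩
    rw [LinearMap.sub_apply, map_sub, map_sub, sub_eq_zero]
    refine (hcomul m q (nested_assoc_comul hq m)).trans ?_
    simp only [LinearMap.comp_apply, Algebra.linearMap_apply, Algebra.algebraMap_eq_smul_one,
      map_smul, Bialgebra.comul_one, Algebra.TensorProduct.one_def, TensorProduct.map_tmul]
  · have h1 : eval k T A (1 ⊗ₜ t) = algebraMap k A (counit (R := k) t) :=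
      congrArg (fun (e : WithConv (T →ₗ[k] A)) ↦ e t) (toFun_one (k := k) (T := T) (A := A))
    rw [LinearMap.sub_apply, TensorProduct.sub_tmul, map_sub, sub_eq_zero, LinearMap.comp_apply,
      heval, LinearMap.comp_apply, Algebra.linearMap_apply,
      Algebra.algebraMap_eq_smul_one (A := MeasCoalg k T A), ← TensorProduct.smul_tmul', map_smul,
      h1, map_mul, Algebra.smul_def]

theorem eval_mul_repr (m m' : MeasCoalg k T A) {t : T} {ι : Type*} (r : Coalgebra.Repr k t ι) :
    eval k T A ((m * m') ⊗ₜ t) =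
      ∑ i ∈ r.index, eval k T A (m ⊗ₜ r.left i) * eval k T A (m' ⊗ₜ r.right i) := by
  rw [← toFun_apply, toFun_mul, r.convMul_apply]
  rfl

theorem eval_algebraMap_smul (m : MeasCoalg k T A) (c : k) :
    eval k T A (m ⊗ₜ (c • (1 : T))) = algebraMap k A (counit (R := k) m * c) := by
  rw [TensorProduct.tmul_smul, map_smul, (isMeasuring_eval k T A).map_one, Algebra.smul_def,
    map_mul, mul_comm]

noncomputable instance : HopfAlgebra k (MeasCoalg k T A) where
  antipode := antipode k T A
  mul_antipode_rTensor_comul := by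
    refine comp_comul_eq_counit (LinearMap.mul' k _ ∘ₗ (antipode k T A).rTensor _)
      (fun x y ↦ ?_) (fun m q h ↦ (comul_antipode_mul q _).trans h) fun m t ↦ ?_
    · simp [counit_antipode]
    · rw [← eval_algebraMap_smul, ← HopfAlgebra.sum_antipode_mul_eq_smul (ℛ k t),
        TensorProduct.tmul_sum, map_sum]
      simp only [(isMeasuring_eval k T A).map_mul_repr (ℛ k m)]
      rw [← (ℛ k m).eq]
      simp only [map_sum, LinearMap.comp_apply, LinearMap.rTensor_tmul, LinearMap.mul'_apply,
        TensorProduct.sum_tmul, eval_mul_repr _ _ (ℛ k t), eval_antipode]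
      exact Finset.sum_comm
  mul_antipode_lTensor_comul := by
    refine comp_comul_eq_counit (LinearMap.mul' k _ ∘ₗ (antipode k T A).lTensor _)
      (fun x y ↦ ?_) (fun m q h ↦ (TensorProduct.comm k _ _).injective
        ((comul_mul_antipode q _).trans (h.trans (by simp)))) fun m t ↦ ?_
    · simp [counit_antipode]
    · rw [← eval_algebraMap_smul, ← HopfAlgebra.sum_mul_antipode_eq_smul (ℛ k t),
        TensorProduct.tmul_sum, map_sum]
      simp only [(isMeasuring_eval k T A).map_mul_repr (ℛ k m)]
      rw [← (ℛ k m).eq]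
      simp only [map_sum, LinearMap.comp_apply, LinearMap.lTensor_tmul, LinearMap.mul'_apply,
        TensorProduct.sum_tmul, eval_mul_repr _ _ (ℛ k t), eval_antipode]
      exact Finset.sum_comm

end MeasCoalg

/-! ### Functoriality and the self-adjunction -/

section Functoriality

variable {k N N' T T' A : Type*} [Field k] [Ring N] [Bialgebra k N] [Ring N'] [Bialgebra k N']
  [Ring T] [Bialgebra k T] [Ring T'] [Bialgebra k T'] [Ring A] [Algebra k A]

theorem IsMeasuring.comp_map {ψ : N ⊗[k] T →ₗ[k] A} (hψ : IsMeasuring ψ) (f : N' →ₐc[k] N)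
    (g : T' →ₐc[k] T) :
    IsMeasuring (ψ ∘ₗ TensorProduct.map (f : N' →ₗ[k] N) (g : T' →ₗ[k] T)) where
  map_mul n t t' :=
    (congrArg (fun y ↦ ψ (f n ⊗ₜ[k] y)) (_root_.map_mul g t t')).trans
      ((hψ.comp_coalgHom (f : N' →ₗc[k] N)).map_mul n (g t) (g t'))
  map_one n :=
    (congrArg (fun y ↦ ψ (f n ⊗ₜ[k] y)) (_root_.map_one g)).trans
      ((hψ.comp_coalgHom (f : N' →ₗc[k] N)).map_one n)

theorem IsBimeasuring.comp_map {ψ : N ⊗[k] T →ₗ[k] A} (hψ : IsBimeasuring ψ) (f : N' →ₐc[k] N)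
    (g : T' →ₐc[k] T) :
    IsBimeasuring (ψ ∘ₗ TensorProduct.map (f : N' →ₗ[k] N) (g : T' →ₗ[k] T)) where
  left := hψ.left.comp_map f g
  right := by
    have h : (ψ ∘ₗ TensorProduct.map (f : N' →ₗ[k] N) (g : T' →ₗ[k] T)) ∘ₗ
        (TensorProduct.comm k T' N').toLinearMap = (ψ ∘ₗ (TensorProduct.comm k T N).toLinearMap) ∘ₗ
          TensorProduct.map (g : T' →ₗ[k] T) (f : N' →ₗ[k] N) :=
      TensorProduct.ext' fun _ _ ↦ rfl
    rw [h]
    exact hψ.right.comp_map g f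

theorem IsBimeasuring.comp_comm {ψ : N ⊗[k] T →ₗ[k] A} (hψ : IsBimeasuring ψ) :
    IsBimeasuring (ψ ∘ₗ (TensorProduct.comm k T N).toLinearMap) where
  left := hψ.right
  right := by
    have h : (ψ ∘ₗ (TensorProduct.comm k T N).toLinearMap) ∘ₗ
        (TensorProduct.comm k N T).toLinearMap = ψ := TensorProduct.ext' fun _ _ ↦ rfl
    rw [h]
    exact hψ.left

/-- Bimeasurings are symmetric in their two arguments. -/
def Bimeas.swap : Bimeas k T N A ≃ Bimeas k N T A where
  toFun ψ := ⟨_, ψ.2.comp_comm⟩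
  invFun ψ := ⟨_, ψ.2.comp_comm⟩
  left_inv _ := Subtype.ext (TensorProduct.ext' fun _ _ ↦ rfl)
  right_inv _ := Subtype.ext (TensorProduct.ext' fun _ _ ↦ rfl)

end Functoriality

namespace MeasCoalg

section

variable {k N S T R A : Type*} [Field k] [Ring N] [Bialgebra k N] [Ring S] [Bialgebra k S]
  [Ring T] [Bialgebra k T] [Ring R] [Bialgebra k R] [CommRing A] [Algebra k A]

variable (A) in
/-- The bialgebra map `M(T, A) → M(S, A)` induced by a bialgebra map `S → T`. -/
noncomputable def map (α : S →ₐc[k] T) : MeasCoalg k T A →ₐc[k] MeasCoalg k S A :=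
  liftBialgHom _ ((isBimeasuring_eval k T A).comp_map (BialgHom.id k _) α)

theorem eval_map (α : S →ₐc[k] T) (m : MeasCoalg k T A) (s : S) :
    eval k S A (map A α m ⊗ₜ s) = eval k T A (m ⊗ₜ α s) :=
  eval_liftBialgHom ..

theorem map_id : map A (BialgHom.id k T) = BialgHom.id k (MeasCoalg k T A) :=
  bialgHom_ext fun m t ↦ eval_map (BialgHom.id k T) m t

theorem map_comp (α : S →ₐc[k] T) (β : R →ₐc[k] S) :
    map A (α.comp β) = (map A β).comp (map A α) :=
  bialgHom_ext fun m r ↦ by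
    rw [eval_map, BialgHom.comp_apply, BialgHom.comp_apply, eval_map, eval_map]

variable (k N T A) in
/-- Bialgebra maps `N → M(T, A)` correspond to bimeasurings `N ⊗ T → A`. -/
noncomputable def bimeasEquiv : (N →ₐc[k] MeasCoalg k T A) ≃ Bimeas k N T A where
  toFun g := ⟨eval k T A ∘ₗ LinearMap.rTensor T (g : N →ₗ[k] MeasCoalg k T A),
    (isBimeasuring_eval k T A).comp_map g (BialgHom.id k T)⟩
  invFun ψ := liftBialgHom ψ.1 ψ.2
  left_inv _ := bialgHom_ext fun _ _ ↦ eval_liftBialgHom ..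
  right_inv _ := Subtype.ext (TensorProduct.ext' fun _ _ ↦ eval_liftBialgHom ..)

variable (k N T A) in
/-- The bijection between bialgebra maps `T → M(N, A)` and `N → M(T, A)`. -/
noncomputable def adjEquiv : (T →ₐc[k] MeasCoalg k N A) ≃ (N →ₐc[k] MeasCoalg k T A) :=
  (bimeasEquiv k T N A).trans (Bimeas.swap.trans (bimeasEquiv k N T A).symm)

theorem eval_adjEquiv (f : T →ₐc[k] MeasCoalg k N A) (n : N) (t : T) :
    eval k T A (adjEquiv k N T A f n ⊗ₜ t) = eval k N A (f t ⊗ₜ n) :=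
  eval_liftBialgHom _ (Bimeas.swap (bimeasEquiv k T N A f)).2 n t

theorem adjEquiv_comp (f : T →ₐc[k] MeasCoalg k N A) (β : S →ₐc[k] T) :
    adjEquiv k N S A (f.comp β) = (map A β).comp (adjEquiv k N T A f) :=
  bialgHom_ext fun n s ↦ by
    rw [BialgHom.comp_apply, eval_map, eval_adjEquiv, eval_adjEquiv, BialgHom.comp_apply]

theorem adjEquiv_symm_comp (g : N →ₐc[k] MeasCoalg k T A) (α : S →ₐc[k] N) :
    (adjEquiv k S T A).symm (g.comp α) = (map A α).comp ((adjEquiv k N T A).symm g) := by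
  obtain ⟨f, rfl⟩ := (adjEquiv k N T A).surjective g
  rw [Equiv.symm_apply_apply, Equiv.symm_apply_eq]
  exact bialgHom_ext fun s t ↦ by
    rw [BialgHom.comp_apply, eval_adjEquiv, eval_adjEquiv, BialgHom.comp_apply, eval_map]

end

variable (k : Type u) [Field k] (A : Type v) [CommRing A] [Algebra k A]

/-- The contravariant functor `T ↦ M(T, A)` on bialgebras. -/
noncomputable def bialgFunctor : (BialgCat.{max u v w} k)ᵒᵖ ⥤ BialgCat.{max u v w} k where
  obj T := BialgCat.of k (MeasCoalg k T.unop A)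
  map α := BialgCat.ofHom (map A α.unop.toBialgHom)
  map_id _ := BialgCat.hom_ext _ _ map_id
  map_comp α β := BialgCat.hom_ext _ _ (map_comp α.unop.toBialgHom β.unop.toBialgHom)

/-- Morphisms of bialgebras as bialgebra maps. -/
def _root_.BialgCat.homEquiv (X Y : BialgCat.{w} k) : (X ⟶ Y) ≃ (X →ₐc[k] Y) where
  toFun f := f.toBialgHom
  invFun f := ⟨f⟩
  left_inv _ := rfl
  right_inv _ := rfl

/-- Morphisms of Hopf algebras as bialgebra maps. -/
def _root_.HopfAlgCat.homEquiv (X Y : HopfAlgCat.{w} k) : (X ⟶ Y) ≃ (X →ₐc[k] Y) where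
  toFun f := f.toBialgHom
  invFun f := ⟨f⟩
  left_inv _ := rfl
  right_inv _ := rfl

variable {k} in
/-- The bijection `adjEquiv` in the category of bialgebras. -/
noncomputable def bialgAdjEquiv (N T : BialgCat.{max u v w} k) :
    (T ⟶ (bialgFunctor.{u, v, w} k A).obj (op N)) ≃
      (N ⟶ (bialgFunctor.{u, v, w} k A).obj (op T)) :=
  (BialgCat.homEquiv k T ((bialgFunctor.{u, v, w} k A).obj (op N))).trans <| (adjEquiv k N T A).trans
    (BialgCat.homEquiv k N ((bialgFunctor.{u, v, w} k A).obj (op T))).symm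

theorem bialgAdjEquiv_comp {N T T' : BialgCat.{max u v w} k} (β : T' ⟶ T)
    (f : T ⟶ (bialgFunctor.{u, v, w} k A).obj (op N)) :
    bialgAdjEquiv A N T' (β ≫ f) = bialgAdjEquiv A N T f ≫ (bialgFunctor k A).map β.op :=
  BialgCat.hom_ext _ _ <| adjEquiv_comp f.toBialgHom β.toBialgHom

theorem bialgAdjEquiv_symm_comp {N N' T : BialgCat.{max u v w} k} (α : N' ⟶ N)
    (g : N ⟶ (bialgFunctor.{u, v, w} k A).obj (op T)) :
    (bialgAdjEquiv A N' T).symm (α ≫ g) =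
      (bialgAdjEquiv A N T).symm g ≫ (bialgFunctor k A).map α.op :=
  BialgCat.hom_ext _ _ <| adjEquiv_symm_comp g.toBialgHom α.toBialgHom

/-- The self-adjunction of `T ↦ M(T, A)` on bialgebras. -/
noncomputable def bialgAdj : (bialgFunctor.{u, v, w} k A).rightOp ⊣ bialgFunctor.{u, v, w} k A :=
  .mkOfHomEquiv
    { homEquiv := fun N T ↦ (opEquiv _ _).trans (bialgAdjEquiv A N T.unop)
      homEquiv_naturality_left_symm := fun α g ↦
        congrArg Quiver.Hom.op (bialgAdjEquiv_symm_comp k A α g)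
      homEquiv_naturality_right := fun f β ↦ bialgAdjEquiv_comp k A β.unop f.unop }

theorem bialgAdj_homEquiv (N T : BialgCat.{max u v w} k)
    (f : T ⟶ (bialgFunctor.{u, v, w} k A).obj (op N)) :
    (bialgAdj k A).homEquiv N (op T) f.op = bialgAdjEquiv A N T f := by
  rw [bialgAdj, Adjunction.mkOfHomEquiv_homEquiv]
  rfl

/-- The contravariant functor `T ↦ M(T, A)` on Hopf algebras. -/
noncomputable def hopfFunctor : (HopfAlgCat.{max u v w} k)ᵒᵖ ⥤ HopfAlgCat.{max u v w} k where
  obj T := HopfAlgCat.of k (MeasCoalg k T.unop A)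
  map α := HopfAlgCat.ofHom (map A α.unop.toBialgHom)
  map_id _ := HopfAlgCat.hom_ext _ _ map_id
  map_comp α β := HopfAlgCat.hom_ext _ _ (map_comp α.unop.toBialgHom β.unop.toBialgHom)

variable {k} in
/-- The bijection `adjEquiv` in the category of Hopf algebras. -/
noncomputable def hopfAdjEquiv (N T : HopfAlgCat.{max u v w} k) :
    (T ⟶ (hopfFunctor.{u, v, w} k A).obj (op N)) ≃
      (N ⟶ (hopfFunctor.{u, v, w} k A).obj (op T)) :=
  (HopfAlgCat.homEquiv k T ((hopfFunctor.{u, v, w} k A).obj (op N))).trans <| (adjEquiv k N T A).trans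
    (HopfAlgCat.homEquiv k N ((hopfFunctor.{u, v, w} k A).obj (op T))).symm

theorem hopfAdjEquiv_comp {N T T' : HopfAlgCat.{max u v w} k} (β : T' ⟶ T)
    (f : T ⟶ (hopfFunctor.{u, v, w} k A).obj (op N)) :
    hopfAdjEquiv A N T' (β ≫ f) = hopfAdjEquiv A N T f ≫ (hopfFunctor k A).map β.op :=
  HopfAlgCat.hom_ext _ _ <| adjEquiv_comp f.toBialgHom β.toBialgHom

theorem hopfAdjEquiv_symm_comp {N N' T : HopfAlgCat.{max u v w} k} (α : N' ⟶ N)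
    (g : N ⟶ (hopfFunctor.{u, v, w} k A).obj (op T)) :
    (hopfAdjEquiv A N' T).symm (α ≫ g) =
      (hopfAdjEquiv A N T).symm g ≫ (hopfFunctor k A).map α.op :=
  HopfAlgCat.hom_ext _ _ <| adjEquiv_symm_comp g.toBialgHom α.toBialgHom

/-- The self-adjunction of `T ↦ M(T, A)` on Hopf algebras. -/
noncomputable def hopfAdj : (hopfFunctor.{u, v, w} k A).rightOp ⊣ hopfFunctor.{u, v, w} k A :=
  .mkOfHomEquiv
    { homEquiv := fun N T ↦ (opEquiv _ _).trans (hopfAdjEquiv A N T.unop)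
      homEquiv_naturality_left_symm := fun α g ↦
        congrArg Quiver.Hom.op (hopfAdjEquiv_symm_comp k A α g)
      homEquiv_naturality_right := fun f β ↦ hopfAdjEquiv_comp k A β.unop f.unop }

theorem hopfAdj_homEquiv (N T : HopfAlgCat.{max u v w} k)
    (f : T ⟶ (hopfFunctor.{u, v, w} k A).obj (op N)) :
    (hopfAdj k A).homEquiv N (op T) f.op = hopfAdjEquiv A N T f := by
  rw [hopfAdj, Adjunction.mkOfHomEquiv_homEquiv]
  rfl

/-- On Hopf algebras the two functors agree. -/
noncomputable def hopfFunctorIso :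
    hopfFunctor.{u, v, w} k A ⋙ forget₂ (HopfAlgCat.{max u v w} k) (BialgCat.{max u v w} k) ≅
      (forget₂ (HopfAlgCat.{max u v w} k) (BialgCat.{max u v w} k)).op ⋙
        bialgFunctor.{u, v, w} k A :=
  NatIso.ofComponents (fun T ↦ Iso.refl (BialgCat.of k (MeasCoalg k T.unop A))) fun _ ↦ rfl

end MeasCoalg

theorem mainTheorem1 {k : Type u} [Field k] {A : Type v} [CommRing A] [Algebra k A] :
    -- a contravariant functor `B(_, A)` on bialgebras, with universal bimeasurings
    ∃ (B : (BialgCat.{max u v w} k)ᵒᵖ ⥤ BialgCat.{max u v w} k)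
      (θ : ∀ T : BialgCat.{max u v w} k, B.obj (op T) ⊗[k] T →ₗ[k] A),
      (∀ T, IsUniversalBimeasuring (θ T)) ∧
      -- the action of `B(_, A)` on a morphism `α` is the one induced by the universal property
      (∀ (S T : BialgCat.{max u v w} k) (α : S ⟶ T),
        θ S ∘ₗ LinearMap.rTensor S (BialgCat.Hom.toLin (B.map α.op)) =
          θ T ∘ₗ LinearMap.lTensor (B.obj (op T)) (BialgCat.Hom.toLin α)) ∧
      -- `B(_, A)` is adjoint to itself on the right
      ∃ (adj : B.rightOp ⊣ B)
        -- `Φ N T : Bialg(N, B(T, A)) ≃ Bimeas(N ⊗ T, A)`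
        (Φ : ∀ N T : BialgCat.{max u v w} k, (N ⟶ B.obj (op T)) ≃ Bimeas k N T A)
        -- `Ψ N T : Bialg(T, B(N, A)) ≃ Bimeas(N ⊗ T, A)`
        (Ψ : ∀ N T : BialgCat.{max u v w} k, (T ⟶ B.obj (op N)) ≃ Bimeas k N T A),
        (∀ N T (g : N ⟶ B.obj (op T)),
          (Φ N T g).1 = θ T ∘ₗ LinearMap.rTensor T (BialgCat.Hom.toLin g)) ∧
        (∀ N T (f : T ⟶ B.obj (op N)),
          (Ψ N T f).1 = θ N ∘ₗ LinearMap.rTensor N (BialgCat.Hom.toLin f) ∘ₗ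
            (TensorProduct.comm k N T).toLinearMap) ∧
        -- the adjunction is the resulting bijection `Bialg(T, B(N, A)) ≃ Bialg(N, B(T, A))`
        (∀ N T (f : T ⟶ B.obj (op N)),
          Φ N T (adj.homEquiv N (op T) f.op) = Ψ N T f) ∧
        -- both bijections are natural in `N` and `T`
        (∀ (N N' T T' : BialgCat.{max u v w} k) (α : N' ⟶ N) (β : T' ⟶ T)
          (g : N ⟶ B.obj (op T)),
          (Φ N' T' (α ≫ g ≫ B.map β.op)).1 = (Φ N T g).1 ∘ₗ
            TensorProduct.map (BialgCat.Hom.toLin α) (BialgCat.Hom.toLin β)) ∧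
        (∀ (N N' T T' : BialgCat.{max u v w} k) (α : N' ⟶ N) (β : T' ⟶ T)
          (f : T ⟶ B.obj (op N)),
          (Ψ N' T' (β ≫ f ≫ B.map α.op)).1 = (Ψ N T f).1 ∘ₗ
            TensorProduct.map (BialgCat.Hom.toLin α) (BialgCat.Hom.toLin β)) ∧
        -- `B(_, A)`, together with its self-adjunction, restricts to Hopf algebras
        ∃ (BH : (HopfAlgCat.{max u v w} k)ᵒᵖ ⥤ HopfAlgCat.{max u v w} k)
          (i : BH ⋙ forget₂ (HopfAlgCat.{max u v w} k) (BialgCat.{max u v w} k) ≅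
            (forget₂ (HopfAlgCat.{max u v w} k) (BialgCat.{max u v w} k)).op ⋙ B)
          (adjH : BH.rightOp ⊣ BH),
          ∀ (N T : HopfAlgCat.{max u v w} k) (f : T ⟶ BH.obj (op N)),
            (forget₂ (HopfAlgCat k) (BialgCat k)).map (adjH.homEquiv N (op T) f.op) ≫
                i.hom.app (op T) =
              adj.homEquiv ((forget₂ (HopfAlgCat k) (BialgCat k)).obj N)
                (op ((forget₂ (HopfAlgCat k) (BialgCat k)).obj T))
                ((forget₂ (HopfAlgCat k) (BialgCat k)).map f ≫ i.hom.app (op N)).op := by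

  refine ⟨MeasCoalg.bialgFunctor.{u, v, w} k A, fun T ↦ MeasCoalg.eval k T A,
    fun T ↦ MeasCoalg.isUniversalBimeasuring_eval, fun S T α ↦ ?_, MeasCoalg.bialgAdj k A,
    fun N T ↦ (BialgCat.homEquiv k N _).trans (MeasCoalg.bimeasEquiv k N T A),
    fun N T ↦ (BialgCat.homEquiv k T _).trans ((MeasCoalg.bimeasEquiv k T N A).trans Bimeas.swap),
    fun N T g ↦ rfl, fun N T f ↦ rfl, fun N T f ↦ ?_, fun N N' T T' α β g ↦ ?_,
    fun N N' T T' α β f ↦ ?_, MeasCoalg.hopfFunctor k A, MeasCoalg.hopfFunctorIso k A,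
    MeasCoalg.hopfAdj k A, fun N T f ↦ ?_⟩
  · exact TensorProduct.ext' fun m s ↦ MeasCoalg.eval_map α.toBialgHom m s
  · refine Subtype.ext (TensorProduct.ext' fun n t ↦ ?_)
    rw [MeasCoalg.bialgAdj_homEquiv]
    exact MeasCoalg.eval_adjEquiv f.toBialgHom n t
  · exact TensorProduct.ext' fun n t ↦
      MeasCoalg.eval_map β.toBialgHom (g.toBialgHom (α.toBialgHom n)) t
  · exact TensorProduct.ext' fun n t ↦
      MeasCoalg.eval_map α.toBialgHom (f.toBialgHom (β.toBialgHom t)) n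
  · rw [MeasCoalg.hopfAdj_homEquiv, MeasCoalg.bialgAdj_homEquiv]
    rfl
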